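/- Let $\Omega\subset\mathbb{R}^3$ be an open set with $C^2$ boundary (near each boundary point, $\Omega=\{\varphi<0\}$ for some $C^2$ function $\varphi$ with nonvanishing gradient), with unit outer normal $\mathbf n(x)$ at $x\in\partial\Omega$. Let $h\ge 0$ be a continuous function on $\mathbb{R}^3\setminus\Omega$ (for instance a smooth one), let $\alpha>0$ and $t>0$, and let $\gamma\in H^2([0,t];\mathbb{R}^3)$ be parameterized by arc length, so that $\mathbf k(s):=\gamma_s(s)$ satisfies $|\mathbf k(s)|=1$ for all $s\in[0,t]$, with $\gamma(s)\notin\Omega$ for all $s\in[0,t]$. Say that $\gamma$ is in a *breakdown configuration* with respect to $\Omega$ if $$\gamma(t)\in\partial\Omega,\qquad \gamma_s(t)=-\mathbf n(\gamma(t)),\qquad \gamma_{ss}(s)=0\ \text{ for all } s\in\,]0,t[\ \text{ such that } \gamma(s)\notin\partial\Omega .$$ For $\omega\in L^2([0,t];\mathbb{R}^3)$ define $$\gamma_t[\omega](s)=\int_0^s\omega(\sigma)\times\bigl(\gamma(s)-\gamma(\sigma)\bigr)\,d\sigma,\qquad \dot P[\omega]=\mathbf k(t)+\int_0^t\omega(\sigma)\times\bigl(\gamma(t)-\gamma(\sigma)\bigr)\,d\sigma,$$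 $$J(\omega)=\int_0^t|\omega(s)|^2\,ds+\int_0^t h(\gamma(s))\,\bigl|\gamma_t[\omega](s)\times\mathbf k(s)\bigr|\,ds+\alpha\,h(\gamma(t))\,\max\bigl\{\langle\dot P[\omega],\mathbf k(t)\rangle,\,0\bigr\}.$$ Let $\mathcal A$ be the set of all $\omega\in L^2([0,t];\mathbb{R}^3)$ such that $$\langle\mathbf n(\gamma(s)),\gamma_t[\omega](s)\rangle\ge 0\quad\text{for all } s\in[0,t] \text{ with } \gamma(s)\in\partial\Omega,$$ and, in case $\gamma(t)\in\partial\Omega$, also $\langle\mathbf n(\gamma(t)),\dot P[\omega]\rangle\ge 0$. If $\gamma$ is not in a breakdown configuration, then $J$ has a unique minimizer over $\mathcal A$: there is exactly one $\omega\in\mathcal A$ (as an element of $L^2([0,t];\mathbb{R}^3)$) such that $J(\omega)\le J(\omega')$ for all $\omega'\in\mathcal A$. -/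

import Mathlib

open MeasureTheory Set Filter Topology

noncomputable section

namespace RootGrowth

/-- Physical space, with its Euclidean norm and inner product. -/
abbrev E3 : Type := EuclideanSpace ℝ (Fin 3)

/-- The cross product on `E3`. -/
def cross (u v : E3) : E3 := WithLp.toLp 2 (crossProduct (WithLp.ofLp u) (WithLp.ofLp v))

/-! ### Obstacles with `C²` boundary -/

/-- `φ` is a local `C²` defining function of `Ω` at the point `x`: it is `C²` near `x`, it vanishes
at `x` with nonzero gradient, and near `x` the set `Ω` is `{φ < 0}`. -/
structure IsDefiningFunctionAt (Ω : Set E3) (x : E3) (φ : E3 → ℝ) : Prop where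
  contDiffAt : ContDiffAt ℝ 2 φ x
  apply_eq_zero : φ x = 0
  gradient_ne_zero : gradient φ x ≠ 0
  eventually_mem_iff : ∀ᶠ y in 𝓝 x, (y ∈ Ω ↔ φ y < 0)

/-- The set `Ω` has `C²` boundary. -/
def HasC2Boundary (Ω : Set E3) : Prop :=
  ∀ x ∈ frontier Ω, ∃ φ : E3 → ℝ, IsDefiningFunctionAt Ω x φ

/-- `ν` is the unit outer normal of `Ω` at `x`: the normalized gradient of a local defining
function. -/
def IsOuterUnitNormal (Ω : Set E3) (x ν : E3) : Prop :=
  ∃ φ : E3 → ℝ, IsDefiningFunctionAt Ω x φ ∧ ν = ‖gradient φ x‖⁻¹ • gradient φ x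

open Classical in
/-- The unit outer normal `n(x)` of `Ω` at a point `x` of a `C²` boundary (`0` where there is none).
It does not depend on the choice of the defining function, see `outerNormal_eq`. -/
def outerNormal (Ω : Set E3) (x : E3) : E3 :=
  if h : ∃ ν, IsOuterUnitNormal Ω x ν then h.choose else 0

theorem IsDefiningFunctionAt.inner_nonpos {Ω : Set E3} {x v : E3} {φ ψ : E3 → ℝ}
    (hφ : IsDefiningFunctionAt Ω x φ) (hψ : IsDefiningFunctionAt Ω x ψ)
    (hv : inner ℝ (gradient φ x) v < 0) : inner ℝ (gradient ψ x) v ≤ 0 := by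
  have key : ∀ {χ : E3 → ℝ}, IsDefiningFunctionAt Ω x χ →
      HasDerivAt (fun r : ℝ => χ (x + r • v)) (inner ℝ (gradient χ x) v) 0 := by
    intro χ hχ
    have hd : DifferentiableAt ℝ χ x := hχ.contDiffAt.differentiableAt (by norm_num)
    have hg : HasFDerivAt χ (InnerProductSpace.toDual ℝ E3 (gradient χ x)) (x + (0 : ℝ) • v) := by
      simpa using hd.hasGradientAt.hasFDerivAt
    have hl : HasDerivAt (fun r : ℝ => x + r • v) v 0 := by
      simpa using ((hasDerivAt_id (0 : ℝ)).smul_const v).const_add x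
    have hc := hg.comp_hasDerivAt (0 : ℝ) hl
    rw [InnerProductSpace.toDual_apply_apply] at hc
    exact hc
  have hcont : Tendsto (fun r : ℝ => x + r • v) (𝓝[>] 0) (𝓝 x) := by
    have hc : Continuous (fun r : ℝ => x + r • v) := by fun_prop
    have := hc.tendsto 0
    simp only [zero_smul, add_zero] at this
    exact this.mono_left nhdsWithin_le_nhds
  by_contra hpos
  push Not at hpos
  have h1 : ∀ᶠ r in 𝓝[>] (0 : ℝ), φ (x + r • v) < 0 := by
    have := (key hφ).tendsto_slope_zero_right.eventually_lt_const hv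
    filter_upwards [this, self_mem_nhdsWithin] with r hr hr0
    have hr0' : (0 : ℝ) < r := hr0
    simp only [zero_add, zero_smul, add_zero, hφ.apply_eq_zero, sub_zero, smul_eq_mul] at hr
    by_contra hcon
    push Not at hcon
    have : 0 ≤ r⁻¹ * φ (x + r • v) := by positivity
    linarith
  have h2 : ∀ᶠ r in 𝓝[>] (0 : ℝ), 0 < ψ (x + r • v) := by
    have := (key hψ).tendsto_slope_zero_right.eventually_const_lt hpos
    filter_upwards [this, self_mem_nhdsWithin] with r hr hr0
    have hr0' : (0 : ℝ) < r := hr0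
    simp only [zero_add, zero_smul, add_zero, hψ.apply_eq_zero, sub_zero, smul_eq_mul] at hr
    exact (pos_iff_pos_of_mul_pos hr).1 (inv_pos.2 hr0')
  obtain ⟨r, hr⟩ := (h1.and (h2.and ((hcont.eventually hφ.eventually_mem_iff).and
    (hcont.eventually hψ.eventually_mem_iff)))).exists
  have := hr.2.2.2.1 (hr.2.2.1.2 hr.1)
  linarith [hr.2.1]

/-- The unit outer normal at a boundary point is unique. -/
theorem IsOuterUnitNormal.unique {Ω : Set E3} {x ν μ : E3}
    (hν : IsOuterUnitNormal Ω x ν) (hμ : IsOuterUnitNormal Ω x μ) : ν = μ := by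
  obtain ⟨φ, hφ, rfl⟩ := hν
  obtain ⟨ψ, hψ, rfl⟩ := hμ
  have H := fun v => IsDefiningFunctionAt.inner_nonpos (v := v) hφ hψ
  have ha := hφ.gradient_ne_zero
  have hb := hψ.gradient_ne_zero
  generalize gradient φ x = a at *
  generalize gradient ψ x = b at *
  have ha' : 0 < ‖a‖ := norm_pos_iff.2 ha
  have hb' : 0 < ‖b‖ := norm_pos_iff.2 hb
  -- test with `v = ‖a‖ b - ‖b‖ a - ε a`
  have hle : ∀ ε : ℝ, 0 < ε → 0 < ‖a‖ * ‖b‖ - inner ℝ a b + ε →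
      ‖a‖ * ‖b‖ ^ 2 - ‖b‖ * inner ℝ a b - ε * inner ℝ a b / ‖a‖ ≤ 0 := by
    intro ε _ hε
    have := H (‖a‖ • b - (‖b‖ + ε / ‖a‖) • a) (by
      simp only [inner_sub_right, inner_smul_right, real_inner_self_eq_norm_sq]
      have : ‖a‖ * inner ℝ a b - (‖b‖ + ε / ‖a‖) * ‖a‖ ^ 2
          = - (‖a‖ * (‖a‖ * ‖b‖ - inner ℝ a b + ε)) := by field_simp; ring
      rw [this]
      have := mul_pos ha' hε
      linarith)
    simp only [inner_sub_right, inner_smul_right, real_inner_self_eq_norm_sq,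
      real_inner_comm] at this
    have e : ‖a‖ * ‖b‖ ^ 2 - ‖b‖ * inner ℝ a b - ε * inner ℝ a b / ‖a‖
        = ‖a‖ * ‖b‖ ^ 2 - (‖b‖ + ε / ‖a‖) * inner ℝ a b := by ring
    rw [e]
    simpa [real_inner_comm] using this
  have hcs : inner ℝ a b ≤ ‖a‖ * ‖b‖ := real_inner_le_norm a b
  have heq : inner ℝ a b = ‖a‖ * ‖b‖ := by
    refine le_antisymm hcs ?_
    have hlim : Tendsto (fun ε : ℝ => ‖a‖ * ‖b‖ ^ 2 - ‖b‖ * inner ℝ a b - ε * inner ℝ a b / ‖a‖)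
        (𝓝[>] 0) (𝓝 (‖a‖ * ‖b‖ ^ 2 - ‖b‖ * inner ℝ a b)) := by
      have hc : Continuous (fun ε : ℝ =>
        ‖a‖ * ‖b‖ ^ 2 - ‖b‖ * inner ℝ a b - ε * inner ℝ a b / ‖a‖) := by fun_prop
      have := hc.tendsto 0
      simp only [zero_mul, zero_div, sub_zero] at this
      exact this.mono_left nhdsWithin_le_nhds
    have h0 : ‖a‖ * ‖b‖ ^ 2 - ‖b‖ * inner ℝ a b ≤ 0 := by
      refine le_of_tendsto hlim ?_
      filter_upwards [self_mem_nhdsWithin] with ε hε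
      have hε' : (0 : ℝ) < ε := hε
      exact hle ε hε' (by linarith)
    have h1 : ‖b‖ * (‖a‖ * ‖b‖) ≤ ‖b‖ * inner ℝ a b := by nlinarith
    exact le_of_mul_le_mul_left h1 hb'
  have := inner_eq_norm_mul_iff_real.1 heq
  have h3 : ‖a‖⁻¹ • (‖b‖⁻¹ • (‖b‖ • a)) = ‖a‖⁻¹ • (‖b‖⁻¹ • (‖a‖ • b)) := by rw [this]
  rw [smul_smul ‖b‖⁻¹, inv_mul_cancel₀ hb'.ne', one_smul, smul_comm ‖b‖⁻¹, smul_smul ‖a‖⁻¹,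
    inv_mul_cancel₀ ha'.ne', one_smul] at h3
  exact h3

theorem outerNormal_eq {Ω : Set E3} {x ν : E3} (h : IsOuterUnitNormal Ω x ν) :
    outerNormal Ω x = ν := by
  have hex : ∃ ν, IsOuterUnitNormal Ω x ν := ⟨ν, h⟩
  rw [outerNormal, dif_pos hex]
  exact hex.choose_spec.unique h

/-! ### Curves -/

/-- The tangent vector `k(s) = γ_s(s)` of a curve on `[0, t]` (one-sided at the end points). -/
def tangent (t : ℝ) (γ : ℝ → E3) (s : ℝ) : E3 := derivWithin γ (Icc 0 t) s

/-- `γ ∈ H²([0, t]; ℝ³)`: the curve is differentiable on `[0, t]` and its derivative is absolutely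
continuous, being the primitive of a square integrable function. -/
def MemH2 (t : ℝ) (γ : ℝ → E3) : Prop :=
  DifferentiableOn ℝ γ (Icc 0 t) ∧
    ∃ κ : ℝ → E3, MemLp κ 2 (volume.restrict (Icc 0 t)) ∧
      ∀ s ∈ Icc 0 t, tangent t γ s = tangent t γ 0 + ∫ σ in (0 : ℝ)..s, κ σ

/-- The curve `γ` on `[0, t]` is in a breakdown configuration with respect to the obstacle `Ω`: the
tip touches the obstacle perpendicularly, and `γ_ss` exists and vanishes at every interior
parameter where the curve does not touch the boundary of the obstacle. -/
def IsBreakdown (Ω : Set E3) (t : ℝ) (γ : ℝ → E3) : Prop :=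
  γ t ∈ frontier Ω ∧ tangent t γ t = -outerNormal Ω (γ t) ∧
    ∀ s ∈ Ioo 0 t, γ s ∉ frontier Ω → HasDerivAt (tangent t γ) 0 s

/-! ### The optimization problem -/

/-- The space `L²([0, t]; ℝ³)` of angular velocities. -/
abbrev AngularVelocity (t : ℝ) : Type := Lp E3 2 (volume.restrict (Icc (0 : ℝ) t))

/-- The velocity `γ_t(t, s) = ∫₀ˢ ω(σ) × (γ(s) - γ(σ)) dσ` produced by `ω`. -/
def velocity {t : ℝ} (γ : ℝ → E3) (ω : AngularVelocity t) (s : ℝ) : E3 :=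
  ∫ σ in (0 : ℝ)..s, cross (ω σ) (γ s - γ σ)

/-- The velocity of the tip, `k(t) + ∫₀ᵗ ω(σ) × (γ(t) - γ(σ)) dσ`. -/
def tipVelocity {t : ℝ} (γ : ℝ → E3) (ω : AngularVelocity t) : E3 :=
  tangent t γ t + ∫ σ in (0 : ℝ)..t, cross (ω σ) (γ t - γ σ)

/-- The cost functional `J = J₁ + J₂ + J₃`. -/
def J (h : E3 → ℝ) (α : ℝ) {t : ℝ} (γ : ℝ → E3) (ω : AngularVelocity t) : ℝ :=
  (∫ s in (0 : ℝ)..t, ‖ω s‖ ^ 2)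
    + (∫ s in (0 : ℝ)..t, h (γ s) * ‖cross (velocity γ ω s) (tangent t γ s)‖)
    + α * h (γ t) * max (inner ℝ (tipVelocity γ ω) (tangent t γ t)) 0

/-- The angular velocities satisfying the two obstacle constraints. -/
def admissible (Ω : Set E3) (t : ℝ) (γ : ℝ → E3) : Set (AngularVelocity t) :=
  {ω | (∀ s ∈ Icc 0 t, γ s ∈ frontier Ω → 0 ≤ inner ℝ (outerNormal Ω (γ s)) (velocity γ ω s)) ∧
    (γ t ∈ frontier Ω → 0 ≤ inner ℝ (outerNormal Ω (γ t)) (tipVelocity γ ω))}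

end RootGrowth

end

/-!
The cost is `‖ω‖²` plus a convex, continuous, nonnegative functional of `ω`, and the admissible set
is closed and convex because the velocity at a fixed parameter is a continuous linear map of
`ω ∈ L²`. By the parallelogram identity, minimizing sequences are then Cauchy
(`existsUnique_minimizer_norm_sq_add`), so there is exactly one minimizer as soon as the obstacle
constraints can be met at all. The theorem therefore reduces to the nonemptiness of the admissible
set outside of breakdown configurations (`admissible_nonempty`).

If the tip is off the obstacle or does not point into it, `ω = 0` is admissible. Otherwise one looks
for an integrable field `Φ`, the primitive of `ω`, for which the velocity is `s ↦ ∫₀ˢ Φ × k`. The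
constraints need only hold with a positive margin, since smooth fields are dense in `L¹` and a
smooth field vanishing at `0` is the primitive of an angular velocity
(`admissible_nonempty_of_rotationField`).

* If the tip hits the boundary obliquely, the curve does not touch the obstacle shortly before the
  tip, and a large rotation concentrated there turns the tip away
  (`admissible_nonempty_of_tangent_ne_neg`).
* If the tip hits the boundary perpendicularly, the curve bends on some contact-free interval
  `[a', b]`, as there is no breakdown. The rotations in the bend generate every velocity at `b`,
  because `∫ (k × z) × k` is injective in `z` when the unit field `k` is not constant
  (`exists_integral_cross_cross_eq`). Beyond `b` the curve is given the velocity `w - μ k`, where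
  `w` is a smooth field pointing outwards at all contact points and `μ' = ⟨k, w'⟩`, so that the
  derivative is orthogonal to `k`, that is, of the form `Φ × k`. Since `k` is tangent to the boundary
  at interior contact points and equals the inner normal at the tip, `⟨n, w - μ k⟩` is positive at
  all contact points (`admissible_nonempty_of_bend`).
-/

open MeasureTheory Set Filter Topology

noncomputable section

namespace RootGrowth

/-! ### Strictly convex minimization in a Hilbert space -/

/-- Adding a convex continuous nonnegative function to the squared norm yields a functional whose
minimizing sequences are Cauchy, by the parallelogram identity. -/
theorem existsUnique_minimizer_norm_sq_add {H : Type*} [NormedAddCommGroup H]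
    [InnerProductSpace ℝ H] [CompleteSpace H] {K : Set H} (hne : K.Nonempty) (hcl : IsClosed K)
    (hconv : Convex ℝ K) {G : H → ℝ} (hG : ConvexOn ℝ univ G) (hGc : Continuous G)
    (hG0 : ∀ x, 0 ≤ G x) :
    ∃! x, x ∈ K ∧ ∀ y ∈ K, ‖x‖ ^ 2 + G x ≤ ‖y‖ ^ 2 + G y := by
  set F : H → ℝ := fun x => ‖x‖ ^ 2 + G x with hF
  have hbdd : BddBelow (F '' K) := ⟨0, by
    rintro _ ⟨x, -, rfl⟩
    have := hG0 x
    simp only [hF]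
    positivity⟩
  set m := sInf (F '' K) with hm
  have hmle : ∀ x ∈ K, m ≤ F x := fun x hx => csInf_le hbdd (mem_image_of_mem F hx)
  have key : ∀ x ∈ K, ∀ y ∈ K, ‖x - y‖ ^ 2 ≤ 2 * (F x - m) + 2 * (F y - m) := by
    intro x hx y hy
    have h1 := hmle _ (hconv hx hy (by norm_num : (0 : ℝ) ≤ 1 / 2)
      (by norm_num : (0 : ℝ) ≤ 1 / 2) (by norm_num))
    have h2 := hG.2 (mem_univ x) (mem_univ y) (by norm_num : (0 : ℝ) ≤ 1 / 2)
      (by norm_num : (0 : ℝ) ≤ 1 / 2) (by norm_num)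
    have h3 : ‖(1 / 2 : ℝ) • x + (1 / 2 : ℝ) • y‖ ^ 2
        = ‖x‖ ^ 2 / 2 + ‖y‖ ^ 2 / 2 - ‖x - y‖ ^ 2 / 4 := by
      rw [norm_add_sq_real, norm_sub_sq_real, norm_smul, norm_smul, real_inner_smul_left,
        real_inner_smul_right]
      norm_num
      ring
    simp only [smul_eq_mul] at h2
    simp only [hF] at h1 ⊢
    linarith
  have hex : ∃ x ∈ K, F x = m := by
    have happ : ∀ n : ℕ, ∃ x ∈ K, F x < m + 1 / ((n : ℝ) + 1) := by
      intro n
      obtain ⟨_, ⟨x, hx, rfl⟩, hlt⟩ := exists_lt_of_csInf_lt (hne.image F)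
        (show sInf (F '' K) < m + 1 / ((n : ℝ) + 1) from lt_add_of_pos_right _ (by positivity))
      exact ⟨x, hx, hlt⟩
    choose u huK hu using happ
    have hFu : Tendsto (fun n => F (u n)) atTop (𝓝 m) := by
      refine tendsto_of_tendsto_of_tendsto_of_le_of_le tendsto_const_nhds ?_
        (fun n => hmle _ (huK n)) (fun n => (hu n).le)
      simpa using tendsto_one_div_add_atTop_nhds_zero_nat.const_add m
    have hcau : CauchySeq u := by
      rw [Metric.cauchySeq_iff]
      intro ε hε
      obtain ⟨N, hN⟩ := eventually_atTop.1
        (hFu.eventually_lt_const (show m < m + ε ^ 2 / 4 by linarith [pow_pos hε 2]))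
      refine ⟨N, fun i hi j hj => ?_⟩
      rw [dist_eq_norm]
      refine lt_of_pow_lt_pow_left₀ 2 hε.le ?_
      linarith [key _ (huK i) _ (huK j), hN i hi, hN j hj]
    obtain ⟨x, hx⟩ := cauchySeq_tendsto_of_complete hcau
    have hFc : Continuous F := by fun_prop
    exact ⟨x, hcl.mem_of_tendsto hx (Eventually.of_forall huK),
      tendsto_nhds_unique ((hFc.tendsto x).comp hx) hFu⟩
  obtain ⟨x, hx, hxm⟩ := hex
  refine ⟨x, ⟨hx, fun y hy => hxm.trans_le (hmle y hy)⟩, ?_⟩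
  rintro y ⟨hy, hymin⟩
  have hym : F y = m := le_antisymm ((hymin x hx).trans hxm.le) (hmle y hy)
  have := key y hy x hx
  rw [hym, hxm] at this
  have h0 : ‖y - x‖ = 0 := by
    have := norm_nonneg (y - x)
    nlinarith
  exact sub_eq_zero.1 (norm_eq_zero.1 h0)

/-! ### The cross product -/

theorem norm_cross_le (u v : E3) : ‖cross u v‖ ≤ ‖u‖ * ‖v‖ := by
  have h := InnerProductGeometry.norm_ofLp_crossProduct u v
  unfold cross
  rw [h]
  exact mul_le_of_le_one_right (by positivity) (Real.sin_le_one _)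

/-- The cross product as a continuous bilinear map. -/
def crossL : E3 →L[ℝ] E3 →L[ℝ] E3 :=
  LinearMap.mkContinuous₂
    (LinearMap.mk₂ ℝ cross (fun u v w => by ext i; simp [cross])
      (fun c u v => by ext i; simp [cross]) (fun u v w => by ext i; simp [cross])
      (fun c u v => by ext i; simp [cross])) 1
    (fun u v => by simpa using norm_cross_le u v)

theorem crossL_apply (u v : E3) : crossL u v = cross u v := rfl

theorem neg_cross (u v : E3) : -cross u v = cross v u := by
  simp only [cross, ← WithLp.toLp_neg, cross_anticomm]

/-- For a unit vector `k`, the operator `v ↦ (k × v) × k` is the projection onto the orthogonal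
complement of `k`. -/
theorem cross_cross_of_norm_eq_one {k : E3} (hk : ‖k‖ = 1) (v : E3) :
    cross (cross k v) k = v - (inner ℝ k v : ℝ) • k := by
  have h1 : k 0 * k 0 + k 1 * k 1 + k 2 * k 2 = 1 := by
    have := EuclideanSpace.real_norm_sq_eq k
    rw [hk, Fin.sum_univ_three] at this
    linarith
  ext i
  fin_cases i <;> simp [cross, PiLp.inner_apply, Fin.sum_univ_three, cross_apply]
  · linear_combination (v 0) * h1
  · linear_combination (v 1) * h1
  · linear_combination (v 2) * h1

theorem intervalIntegrable_cross {f g : ℝ → E3} {a b : ℝ} (hf : IntervalIntegrable f volume a b)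
    (hg : ContinuousOn g (uIcc a b)) :
    IntervalIntegrable (fun σ => cross (f σ) (g σ)) volume a b := by
  have hb : IntervalIntegrable (fun σ => ‖f σ‖ * ‖g σ‖) volume a b :=
    hf.norm.mul_continuousOn hg.norm
  rw [intervalIntegrable_iff] at hf hb ⊢
  have hgm : AEStronglyMeasurable g (volume.restrict (uIoc a b)) :=
    (hg.mono uIoc_subset_uIcc).aestronglyMeasurable measurableSet_uIoc
  exact hb.mono' (crossL.aestronglyMeasurable_comp₂ hf.aestronglyMeasurable hgm)
    (Eventually.of_forall fun σ => norm_cross_le _ _)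

/-! ### Angular velocities, the velocities they produce, and the cost -/

section Cost

variable {t : ℝ} {γ : ℝ → E3}

theorem AngularVelocity.intervalIntegrable (ω : AngularVelocity t) {s : ℝ} (hs : s ∈ Icc 0 t) :
    IntervalIntegrable ω volume 0 s := by
  rw [intervalIntegrable_iff_integrableOn_Icc_of_le hs.1]
  exact IntegrableOn.mono_set ((Lp.memLp ω).integrable one_le_two) (Icc_subset_Icc_right hs.2)

theorem intervalIntegrable_velocity (hγ : ContinuousOn γ (Icc 0 t)) (ω : AngularVelocity t)
    {s : ℝ} (hs : s ∈ Icc 0 t) :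
    IntervalIntegrable (fun σ => cross (ω σ) (γ s - γ σ)) volume 0 s := by
  refine intervalIntegrable_cross (ω.intervalIntegrable hs) ?_
  rw [uIcc_of_le hs.1]
  exact continuousOn_const.sub (hγ.mono (Icc_subset_Icc_right hs.2))

/-- An almost everywhere identity on `[0, t]` holds under integrals over subintervals. -/
theorem intervalIntegral_congr_of_ae_restrict {F : Type*} [NormedAddCommGroup F] [NormedSpace ℝ F]
    {f g : ℝ → F} {s : ℝ} (hs : s ∈ Icc 0 t)
    (h : f =ᵐ[volume.restrict (Icc 0 t)] g) : ∫ σ in (0 : ℝ)..s, f σ = ∫ σ in (0 : ℝ)..s, g σ := by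
  rw [EventuallyEq, ae_restrict_iff' measurableSet_Icc] at h
  refine intervalIntegral.integral_congr_ae ?_
  filter_upwards [h] with σ hσ hmem
  rw [uIoc_of_le hs.1] at hmem
  exact hσ ⟨hmem.1.le, hmem.2.trans hs.2⟩

theorem velocity_add (hγ : ContinuousOn γ (Icc 0 t)) (ω η : AngularVelocity t)
    {s : ℝ} (hs : s ∈ Icc 0 t) : velocity γ (ω + η) s = velocity γ ω s + velocity γ η s := by
  unfold velocity
  rw [← intervalIntegral.integral_add (intervalIntegrable_velocity hγ ω hs)
    (intervalIntegrable_velocity hγ η hs)]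
  refine intervalIntegral_congr_of_ae_restrict hs ?_
  filter_upwards [Lp.coeFn_add ω η] with σ hσ
  simp only [hσ, Pi.add_apply, ← crossL_apply, map_add, add_apply]

theorem velocity_smul (c : ℝ) (ω : AngularVelocity t)
    {s : ℝ} (hs : s ∈ Icc 0 t) : velocity γ (c • ω) s = c • velocity γ ω s := by
  unfold velocity
  rw [← intervalIntegral.integral_smul]
  refine intervalIntegral_congr_of_ae_restrict hs ?_
  filter_upwards [Lp.coeFn_smul c ω] with σ hσ
  simp only [hσ, Pi.smul_apply, ← crossL_apply, map_smul, smul_apply]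

theorem continuousOn_velocity (hγ : ContinuousOn γ (Icc 0 t)) (ω : AngularVelocity t) :
    ContinuousOn (velocity γ ω) (Icc 0 t) := by
  have hint : ∀ f : ℝ → E3, (∀ s ∈ Icc 0 t, IntervalIntegrable f volume 0 s) →
      ContinuousOn (fun s => ∫ σ in (0 : ℝ)..s, f σ) (Icc 0 t) := by
    intro f hf s hs
    have ht : (0 : ℝ) ≤ t := hs.1.trans hs.2
    have := intervalIntegral.continuousOn_primitive_interval (f := f) (μ := volume)
      (a := 0) (b := t) (by
        rw [uIcc_of_le ht]
        exact (intervalIntegrable_iff_integrableOn_Icc_of_le ht).1 (hf t ⟨ht, le_rfl⟩))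
    rw [uIcc_of_le ht] at this
    exact this s hs
  have hω : ∀ s ∈ Icc 0 t, IntervalIntegrable (fun σ => cross (ω σ) (γ σ)) volume 0 s :=
    fun s hs => intervalIntegrable_cross (ω.intervalIntegrable hs)
      (by rw [uIcc_of_le hs.1]; exact hγ.mono (Icc_subset_Icc_right hs.2))
  have heq : EqOn (velocity γ ω) (fun s => crossL (∫ σ in (0 : ℝ)..s, ω σ) (γ s)
      - ∫ σ in (0 : ℝ)..s, cross (ω σ) (γ σ)) (Icc 0 t) := by
    intro s hs
    have h1 := (crossL.flip (γ s)).intervalIntegral_comp_comm (ω.intervalIntegrable hs)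
    simp only [ContinuousLinearMap.flip_apply] at h1
    simp only [velocity]
    rw [← h1]
    simp only [crossL_apply]
    rw [← intervalIntegral.integral_sub
      (intervalIntegrable_cross (ω.intervalIntegrable hs) continuousOn_const) (hω s hs)]
    simp only [← crossL_apply, map_sub]
  refine ContinuousOn.congr ?_ heq
  exact ((crossL.continuous.comp_continuousOn (hint ω fun s hs => ω.intervalIntegrable hs)).clm_apply
    hγ).sub (hint _ hω)

theorem exists_norm_velocity_le (hγ : ContinuousOn γ (Icc 0 t)) :
    ∃ C, 0 ≤ C ∧ ∀ (ω : AngularVelocity t), ∀ s ∈ Icc 0 t, ‖velocity γ ω s‖ ≤ C * ‖ω‖ := by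
  obtain ⟨M, hM⟩ := isCompact_Icc.exists_bound_of_continuousOn hγ
  obtain ⟨B, hB0, hB⟩ : ∃ B, 0 ≤ B ∧ ∀ ω : AngularVelocity t,
      ∫ σ in Icc 0 t, ‖ω σ‖ ≤ B * ‖ω‖ := by
    refine ⟨(volume.restrict (Icc (0 : ℝ) t) univ ^ (1 / (1 : ENNReal).toReal
      - 1 / (2 : ENNReal).toReal)).toReal, ENNReal.toReal_nonneg, fun ω => ?_⟩
    have h1 := eLpNorm_le_eLpNorm_mul_rpow_measure_univ (μ := volume.restrict (Icc (0 : ℝ) t))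
      (p := 1) (q := 2) one_le_two (Lp.aestronglyMeasurable ω)
    rw [integral_norm_eq_lintegral_enorm (Lp.aestronglyMeasurable ω),
      ← eLpNorm_one_eq_lintegral_enorm, Lp.norm_def, mul_comm, ← ENNReal.toReal_mul]
    refine ENNReal.toReal_mono (ENNReal.mul_ne_top (Lp.eLpNorm_ne_top ω) ?_) h1
    exact ENNReal.rpow_ne_top_of_nonneg (by norm_num) (measure_ne_top _ _)
  refine ⟨2 * |M| * B, by positivity, fun ω s hs => ?_⟩
  have hle : ∀ σ ∈ Icc 0 t, ‖cross (ω σ) (γ s - γ σ)‖ ≤ 2 * |M| * ‖ω σ‖ := by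
    intro σ hσ
    refine (norm_cross_le _ _).trans ?_
    rw [mul_comm]
    refine mul_le_mul_of_nonneg_right ?_ (norm_nonneg _)
    have := norm_sub_le (γ s) (γ σ)
    linarith [hM s hs, hM σ hσ, le_abs_self M]
  have hωi : IntegrableOn (fun σ => 2 * |M| * ‖ω σ‖) (Icc 0 t) :=
    (((Lp.memLp ω).integrable one_le_two).norm).const_mul _
  calc ‖velocity γ ω s‖ ≤ ∫ σ in (0 : ℝ)..s, 2 * |M| * ‖ω σ‖ := by
        refine intervalIntegral.norm_integral_le_of_norm_le hs.1 ?_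
          ((ω.intervalIntegrable hs).norm.const_mul _)
        exact Eventually.of_forall fun σ hσ => hle σ ⟨hσ.1.le, hσ.2.trans hs.2⟩
    _ = ∫ σ in Ioc 0 s, 2 * |M| * ‖ω σ‖ := intervalIntegral.integral_of_le hs.1
    _ ≤ ∫ σ in Icc 0 t, 2 * |M| * ‖ω σ‖ := by
        refine setIntegral_mono_set hωi (Eventually.of_forall fun σ => by positivity) ?_
        exact (Ioc_subset_Icc_self.trans (Icc_subset_Icc_right hs.2)).eventuallyLE
    _ = 2 * |M| * ∫ σ in Icc 0 t, ‖ω σ‖ := integral_const_mul _ _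
    _ ≤ 2 * |M| * B * ‖ω‖ := by
        rw [mul_assoc (2 * |M|)]
        exact mul_le_mul_of_nonneg_left (hB ω) (by positivity)

/-- The velocity at a fixed parameter of `[0, t]`, as a continuous linear map of the angular
velocity. -/
def velocityL (hγ : ContinuousOn γ (Icc 0 t)) {s : ℝ} (hs : s ∈ Icc 0 t) :
    AngularVelocity t →L[ℝ] E3 :=
  LinearMap.mkContinuous
    { toFun := fun ω => velocity γ ω s
      map_add' := fun ω η => velocity_add hγ ω η hs
      map_smul' := fun c ω => velocity_smul c ω hs }
    (exists_norm_velocity_le hγ).choose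
    (fun ω => (exists_norm_velocity_le hγ).choose_spec.2 ω s hs)

theorem velocityL_apply (hγ : ContinuousOn γ (Icc 0 t)) {s : ℝ} (hs : s ∈ Icc 0 t)
    (ω : AngularVelocity t) : velocityL hγ hs ω = velocity γ ω s := rfl

theorem tipVelocity_eq (ω : AngularVelocity t) :
    tipVelocity γ ω = tangent t γ t + velocity γ ω t := rfl

theorem isClosed_admissible (hγ : ContinuousOn γ (Icc 0 t)) (ht : 0 < t) (Ω : Set E3) :
    IsClosed (admissible Ω t γ) := by
  have htt : t ∈ Icc 0 t := ⟨ht.le, le_rfl⟩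
  have hset : admissible Ω t γ =
      (⋂ s, ⋂ hs : s ∈ Icc 0 t, ⋂ _ : γ s ∈ frontier Ω,
        {ω | 0 ≤ inner ℝ (outerNormal Ω (γ s)) (velocityL hγ hs ω)}) ∩
      ⋂ _ : γ t ∈ frontier Ω,
        {ω | 0 ≤ inner ℝ (outerNormal Ω (γ t)) (tangent t γ t + velocityL hγ htt ω)} := by
    ext ω
    simp [admissible, velocityL_apply, tipVelocity_eq]
  rw [hset]
  refine IsClosed.inter ?_ ?_
  · refine isClosed_iInter fun s => isClosed_iInter fun hs => isClosed_iInter fun _ => ?_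
    exact isClosed_le continuous_const (by fun_prop)
  · exact isClosed_iInter fun _ => isClosed_le continuous_const (by fun_prop)

theorem convex_admissible (hγ : ContinuousOn γ (Icc 0 t)) (ht : 0 < t) (Ω : Set E3) :
    Convex ℝ (admissible Ω t γ) := by
  have htt : t ∈ Icc 0 t := ⟨ht.le, le_rfl⟩
  intro ω hω η hη a b ha hb hab
  have hlin : ∀ s ∈ Icc 0 t,
      velocity γ (a • ω + b • η) s = a • velocity γ ω s + b • velocity γ η s := by
    intro s hs
    rw [velocity_add hγ _ _ hs, velocity_smul a ω hs, velocity_smul b η hs]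
  refine ⟨fun s hs hsf => ?_, fun hf => ?_⟩
  · rw [hlin s hs, inner_add_right, real_inner_smul_right, real_inner_smul_right]
    exact add_nonneg (mul_nonneg ha (hω.1 s hs hsf)) (mul_nonneg hb (hη.1 s hs hsf))
  · have h1 := mul_nonneg ha (hω.2 hf)
    have h2 := mul_nonneg hb (hη.2 hf)
    rw [tipVelocity_eq, inner_add_right] at h1 h2 ⊢
    rw [hlin t htt, inner_add_right, real_inner_smul_right, real_inner_smul_right]
    have h3 : inner ℝ (outerNormal Ω (γ t)) (tangent t γ t)
        = a * inner ℝ (outerNormal Ω (γ t)) (tangent t γ t)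
          + b * inner ℝ (outerNormal Ω (γ t)) (tangent t γ t) := by
      rw [← add_mul, hab, one_mul]
    rw [h3]
    linarith

/-- The term `J₂` of the cost: the velocity of the curve transverse to itself, weighted by `h`. -/
def displacementCost (h : E3 → ℝ) (γ : ℝ → E3) (ω : AngularVelocity t) : ℝ :=
  ∫ s in (0 : ℝ)..t, h (γ s) * ‖cross (velocity γ ω s) (tangent t γ s)‖

/-- The term `J₃` of the cost, which penalizes a tip that advances in its own direction. -/
def tipCost (h : E3 → ℝ) (α : ℝ) (γ : ℝ → E3) (ω : AngularVelocity t) : ℝ :=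
  α * h (γ t) * max (inner ℝ (tipVelocity γ ω) (tangent t γ t)) 0

theorem J_eq (ht : 0 ≤ t) (h : E3 → ℝ) (α : ℝ) (ω : AngularVelocity t) :
    J h α γ ω = ‖ω‖ ^ 2 + (displacementCost h γ ω + tipCost h α γ ω) := by
  have h1 : ∫ s in (0 : ℝ)..t, ‖ω s‖ ^ 2 = ‖ω‖ ^ 2 := by
    rw [intervalIntegral.integral_of_le ht, ← integral_Icc_eq_integral_Ioc,
      ← real_inner_self_eq_norm_sq ω, L2.inner_def]
    simp only [real_inner_self_eq_norm_sq]
  rw [J, h1, displacementCost, tipCost]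
  ring

theorem convexOn_tipCost (hγ : ContinuousOn γ (Icc 0 t)) (ht : 0 < t) {h : E3 → ℝ} {α : ℝ}
    (hc : 0 ≤ α * h (γ t)) :
    ConvexOn ℝ univ (fun ω : AngularVelocity t => tipCost h α γ ω) := by
  have htt : t ∈ Icc 0 t := ⟨ht.le, le_rfl⟩
  have haff : ConvexOn ℝ univ
      (fun ω : AngularVelocity t => inner ℝ (tipVelocity γ ω) (tangent t γ t)) := by
    have h1 := ((innerSL ℝ (tangent t γ t)).comp (velocityL hγ htt)).toLinearMap.convexOn
      (convex_univ (𝕜 := ℝ))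
    have h2 := h1.add_const (inner ℝ (tangent t γ t) (tangent t γ t))
    refine h2.congr fun ω _ => ?_
    simp [tipVelocity_eq, velocityL_apply, inner_add_left, real_inner_comm, add_comm]
  exact (haff.sup (convexOn_const 0 convex_univ)).smul hc

theorem continuous_tipCost (hγ : ContinuousOn γ (Icc 0 t)) (ht : 0 < t) (h : E3 → ℝ) (α : ℝ) :
    Continuous (fun ω : AngularVelocity t => tipCost h α γ ω) := by
  have htt : t ∈ Icc 0 t := ⟨ht.le, le_rfl⟩
  have heq : (fun ω : AngularVelocity t => tipCost h α γ ω) = fun ω =>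
      α * h (γ t) * max (inner ℝ (tangent t γ t + velocityL hγ htt ω) (tangent t γ t)) 0 := rfl
  rw [heq]
  fun_prop

theorem intervalIntegrable_displacementCost (ht : 0 ≤ t) (hγ : ContinuousOn γ (Icc 0 t))
    (hk : ContinuousOn (tangent t γ) (Icc 0 t)) {h : E3 → ℝ}
    (hh : ContinuousOn (fun s => h (γ s)) (Icc 0 t)) (ω : AngularVelocity t) :
    IntervalIntegrable (fun s => h (γ s) * ‖cross (velocity γ ω s) (tangent t γ s)‖)
      volume 0 t := by
  refine ContinuousOn.intervalIntegrable ?_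
  rw [uIcc_of_le ht]
  exact hh.mul ((crossL.continuous.comp_continuousOn (continuousOn_velocity hγ ω)).clm_apply hk).norm

theorem convexOn_displacementCost (ht : 0 ≤ t) (hγ : ContinuousOn γ (Icc 0 t))
    (hk : ContinuousOn (tangent t γ) (Icc 0 t)) {h : E3 → ℝ}
    (hh : ContinuousOn (fun s => h (γ s)) (Icc 0 t)) (hh0 : ∀ s ∈ Icc 0 t, 0 ≤ h (γ s)) :
    ConvexOn ℝ univ (fun ω : AngularVelocity t => displacementCost h γ ω) := by
  have hint := intervalIntegrable_displacementCost ht hγ hk hh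
  refine ⟨convex_univ, fun ω _ η _ a b ha hb _ => ?_⟩
  simp only [displacementCost, smul_eq_mul]
  rw [← intervalIntegral.integral_const_mul, ← intervalIntegral.integral_const_mul,
    ← intervalIntegral.integral_add ((hint ω).const_mul a) ((hint η).const_mul b)]
  refine intervalIntegral.integral_mono_on ht (hint _)
    (((hint ω).const_mul a).add ((hint η).const_mul b)) fun s hs => ?_
  rw [velocity_add hγ _ _ hs, velocity_smul a ω hs, velocity_smul b η hs]
  have h1 : ‖cross (a • velocity γ ω s + b • velocity γ η s) (tangent t γ s)‖
      ≤ a * ‖cross (velocity γ ω s) (tangent t γ s)‖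
        + b * ‖cross (velocity γ η s) (tangent t γ s)‖ := by
    simp only [← crossL_apply, map_add, map_smul, add_apply,
      smul_apply]
    refine (norm_add_le _ _).trans (le_of_eq ?_)
    rw [norm_smul, norm_smul, Real.norm_of_nonneg ha, Real.norm_of_nonneg hb]
  calc _ ≤ _ := mul_le_mul_of_nonneg_left h1 (hh0 s hs)
    _ = _ := by ring

theorem continuous_displacementCost (ht : 0 ≤ t) (hγ : ContinuousOn γ (Icc 0 t))
    (hk : ContinuousOn (tangent t γ) (Icc 0 t)) {h : E3 → ℝ}
    (hh : ContinuousOn (fun s => h (γ s)) (Icc 0 t)) (hk1 : ∀ s ∈ Icc 0 t, ‖tangent t γ s‖ = 1) :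
    Continuous (fun ω : AngularVelocity t => displacementCost h γ ω) := by
  have hint := intervalIntegrable_displacementCost ht hγ hk hh
  obtain ⟨M, hM⟩ := isCompact_Icc.exists_bound_of_continuousOn hh
  obtain ⟨C, hC0, hC⟩ := exists_norm_velocity_le hγ
  have hlip : ∀ ω η : AngularVelocity t,
      |displacementCost h γ ω - displacementCost h γ η| ≤ |M| * C * |t - 0| * ‖ω - η‖ := by
    intro ω η
    rw [displacementCost, displacementCost, ← intervalIntegral.integral_sub (hint ω) (hint η)]
    have := intervalIntegral.norm_integral_le_of_norm_le_const (a := 0) (b := t)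
      (C := |M| * C * ‖ω - η‖) (f := fun s =>
        h (γ s) * ‖cross (velocity γ ω s) (tangent t γ s)‖
          - h (γ s) * ‖cross (velocity γ η s) (tangent t γ s)‖) (by
        intro s hs
        rw [uIoc_of_le ht] at hs
        have hs' : s ∈ Icc 0 t := Ioc_subset_Icc_self hs
        rw [← mul_sub, norm_mul, mul_assoc]
        refine mul_le_mul ((hM s hs').trans (le_abs_self M)) ?_ (norm_nonneg _) (abs_nonneg M)
        refine (abs_norm_sub_norm_le _ _).trans ?_
        have hsub : velocity γ (ω - η) s = velocity γ ω s - velocity γ η s := by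
          simp only [← velocityL_apply hγ hs', map_sub]
        have h2 := norm_cross_le (velocity γ (ω - η) s) (tangent t γ s)
        rw [hk1 s hs', mul_one, hsub] at h2
        simp only [← crossL_apply, map_sub, sub_apply] at h2 ⊢
        refine h2.trans ?_
        rw [← hsub]
        exact hC _ s hs')
    rw [Real.norm_eq_abs] at this
    linarith
  refine (LipschitzWith.of_dist_le_mul (K := ⟨|M| * C * |t - 0|, by positivity⟩)
    fun ω η => ?_).continuous
  rw [Real.dist_eq, dist_eq_norm]
  exact hlip ω η

theorem displacementCost_nonneg (ht : 0 ≤ t) {h : E3 → ℝ} (hh0 : ∀ s ∈ Icc 0 t, 0 ≤ h (γ s))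
    (ω : AngularVelocity t) : 0 ≤ displacementCost h γ ω :=
  intervalIntegral.integral_nonneg ht fun s hs => mul_nonneg (hh0 s hs) (norm_nonneg _)

/-- The cost has a unique minimizer as soon as the obstacle constraints can be met. -/
theorem existsUnique_minimizer_of_admissible_nonempty {Ω : Set E3} {h : E3 → ℝ} {α : ℝ}
    (ht : 0 < t) (hγ : ContinuousOn γ (Icc 0 t)) (hk : ContinuousOn (tangent t γ) (Icc 0 t))
    (hh : ContinuousOn (fun s => h (γ s)) (Icc 0 t)) (hh0 : ∀ s ∈ Icc 0 t, 0 ≤ h (γ s))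
    (hk1 : ∀ s ∈ Icc 0 t, ‖tangent t γ s‖ = 1) (hα : 0 ≤ α) (hne : (admissible Ω t γ).Nonempty) :
    ∃! ω : AngularVelocity t, ω ∈ admissible Ω t γ ∧
      ∀ ω' ∈ admissible Ω t γ, J h α γ ω ≤ J h α γ ω' := by
  have hc : 0 ≤ α * h (γ t) := mul_nonneg hα (hh0 t ⟨ht.le, le_rfl⟩)
  simp only [J_eq ht.le]
  refine existsUnique_minimizer_norm_sq_add hne (isClosed_admissible hγ ht Ω)
    (convex_admissible hγ ht Ω)
    ((convexOn_displacementCost ht.le hγ hk hh hh0).add (convexOn_tipCost hγ ht hc))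
    ((continuous_displacementCost ht.le hγ hk hh hk1).add (continuous_tipCost hγ ht h α))
    fun ω => add_nonneg (displacementCost_nonneg ht.le hh0 ω) ?_
  exact mul_nonneg hc (le_max_right _ _)

end Cost

/-! ### The outer normal along the boundary and along the curve -/

section Normal

variable {Ω : Set E3}

theorem IsDefiningFunctionAt.continuousAt_gradient {x : E3} {φ : E3 → ℝ}
    (hφ : IsDefiningFunctionAt Ω x φ) : ContinuousAt (gradient φ) x :=
  (InnerProductSpace.toDual ℝ E3).symm.continuous.continuousAt.comp
    ((hφ.contDiffAt.fderiv_right (m := 1) (by norm_num)).continuousAt)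

theorem IsDefiningFunctionAt.eventually {x : E3} {φ : E3 → ℝ} (hΩ : IsOpen Ω)
    (hφ : IsDefiningFunctionAt Ω x φ) :
    ∀ᶠ y in 𝓝 x, y ∈ frontier Ω → IsDefiningFunctionAt Ω y φ := by
  filter_upwards [hφ.contDiffAt.eventually (by simp),
    hφ.continuousAt_gradient.eventually_ne hφ.gradient_ne_zero,
    hφ.eventually_mem_iff.eventually_nhds] with y h1 h2 h3 hy
  refine ⟨h1, le_antisymm ?_ ?_, h2, h3⟩
  · by_contra hcon
    push Not at hcon
    have h4 : ∀ᶠ z in 𝓝 y, z ∉ Ω := by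
      filter_upwards [h3, h1.continuousAt.eventually_const_lt hcon] with z hz hpos hzΩ
      exact absurd (hz.1 hzΩ) (not_lt.2 hpos.le)
    exact mem_closure_iff_frequently.1 (frontier_subset_closure hy) h4
  · have hyΩ : y ∉ Ω := by
      rw [hΩ.frontier_eq] at hy
      exact hy.2
    exact not_lt.1 fun hlt => hyΩ (h3.self_of_nhds.2 hlt)

theorem IsDefiningFunctionAt.outerNormal_eq {x : E3} {φ : E3 → ℝ}
    (hφ : IsDefiningFunctionAt Ω x φ) :
    outerNormal Ω x = ‖gradient φ x‖⁻¹ • gradient φ x :=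
  RootGrowth.outerNormal_eq ⟨φ, hφ, rfl⟩

theorem norm_outerNormal (hΩ2 : HasC2Boundary Ω) {x : E3} (hx : x ∈ frontier Ω) :
    ‖outerNormal Ω x‖ = 1 := by
  obtain ⟨φ, hφ⟩ := hΩ2 x hx
  rw [hφ.outerNormal_eq, norm_smul, norm_inv, norm_norm,
    inv_mul_cancel₀ (norm_ne_zero_iff.2 hφ.gradient_ne_zero)]

theorem continuousOn_outerNormal (hΩ : IsOpen Ω) (hΩ2 : HasC2Boundary Ω) :
    ContinuousOn (outerNormal Ω) (frontier Ω) := by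
  intro x hx
  obtain ⟨φ, hφ⟩ := hΩ2 x hx
  have hc : ContinuousAt (fun y => ‖gradient φ y‖⁻¹ • gradient φ y) x :=
    (hφ.continuousAt_gradient.norm.inv₀ (norm_ne_zero_iff.2 hφ.gradient_ne_zero)).smul
      hφ.continuousAt_gradient
  refine hc.continuousWithinAt.congr_of_eventuallyEq ?_ hφ.outerNormal_eq
  filter_upwards [nhdsWithin_le_nhds (hφ.eventually hΩ), self_mem_nhdsWithin] with y hy hyf
  exact (hy hyf).outerNormal_eq

theorem hasDerivAt_tangent {t : ℝ} {γ : ℝ → E3} (hγ : DifferentiableOn ℝ γ (Icc 0 t)) {s : ℝ}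
    (hs : s ∈ Ioo 0 t) : HasDerivAt γ (tangent t γ s) s :=
  (hγ s (Ioo_subset_Icc_self hs)).hasDerivWithinAt.hasDerivAt (Icc_mem_nhds hs.1 hs.2)

/-- At an interior parameter where the curve touches the obstacle from outside, it is tangent to the
boundary, because a defining function has a minimum there along the curve. -/
theorem inner_outerNormal_tangent_eq_zero (hΩ2 : HasC2Boundary Ω) {t : ℝ} {γ : ℝ → E3}
    (hγ : DifferentiableOn ℝ γ (Icc 0 t)) (hout : ∀ s ∈ Icc 0 t, γ s ∉ Ω) {s : ℝ}
    (hs : s ∈ Ioo 0 t) (hf : γ s ∈ frontier Ω) :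
    inner ℝ (outerNormal Ω (γ s)) (tangent t γ s) = 0 := by
  obtain ⟨φ, hφ⟩ := hΩ2 _ hf
  have hd := hasDerivAt_tangent hγ hs
  have hg := (hφ.contDiffAt.differentiableAt (by norm_num)).hasGradientAt.hasFDerivAt
  have hc := hg.comp_hasDerivAt s hd
  rw [InnerProductSpace.toDual_apply_apply] at hc
  have hmin : IsLocalMin (φ ∘ γ) s := by
    filter_upwards [hd.continuousAt.eventually hφ.eventually_mem_iff, Icc_mem_nhds hs.1 hs.2]
      with r hr hr'
    simp only [Function.comp, hφ.apply_eq_zero]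
    exact not_lt.1 fun hlt => hout r hr' (hr.2 hlt)
  rw [hφ.outerNormal_eq, real_inner_smul_left, hmin.hasDerivAt_eq_zero hc, mul_zero]

/-- The parameters at which the curve touches the boundary of the obstacle. -/
def contactSet (Ω : Set E3) (t : ℝ) (γ : ℝ → E3) : Set ℝ := {s ∈ Icc 0 t | γ s ∈ frontier Ω}

theorem continuousOn_outerNormal_comp (hΩ : IsOpen Ω) (hΩ2 : HasC2Boundary Ω) {t : ℝ} {γ : ℝ → E3}
    (hγ : ContinuousOn γ (Icc 0 t)) :
    ContinuousOn (fun s => outerNormal Ω (γ s)) (contactSet Ω t γ) :=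
  (continuousOn_outerNormal hΩ hΩ2).comp (hγ.mono fun _ hs => hs.1) fun _ hs => hs.2

/-- If the tip hits the obstacle transversally, the curve does not touch the obstacle shortly before
the tip. -/
theorem exists_forall_notMem_frontier (hΩ : IsOpen Ω) (hΩ2 : HasC2Boundary Ω) {t : ℝ} (ht : 0 < t)
    {γ : ℝ → E3} (hγ : DifferentiableOn ℝ γ (Icc 0 t))
    (hk : ContinuousOn (tangent t γ) (Icc 0 t)) (hout : ∀ s ∈ Icc 0 t, γ s ∉ Ω)
    (htf : γ t ∈ frontier Ω) (htr : inner ℝ (outerNormal Ω (γ t)) (tangent t γ t) ≠ 0) :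
    ∃ c ∈ Ico 0 t, ∀ s ∈ Ioo c t, γ s ∉ frontier Ω := by
  have htC : t ∈ contactSet Ω t γ := ⟨⟨ht.le, le_rfl⟩, htf⟩
  have hcont : ContinuousWithinAt (fun s => (inner ℝ (outerNormal Ω (γ s)) (tangent t γ s) : ℝ))
      (contactSet Ω t γ) t :=
    ((continuousOn_outerNormal_comp hΩ hΩ2 hγ.continuousOn).inner
      (hk.mono fun _ hs => hs.1)) t htC
  have hev := eventually_nhdsWithin_iff.1 (hcont.eventually_ne htr)
  obtain ⟨c, hc, hcs⟩ := exists_Ioc_subset_of_mem_nhds' hev ht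
  refine ⟨c, hc, fun s hs hsf => ?_⟩
  have hs0 : s ∈ Ioo 0 t := ⟨hc.1.trans_lt hs.1, hs.2⟩
  exact hcs ⟨hs.1, hs.2.le⟩ ⟨Ioo_subset_Icc_self hs0, hsf⟩
    (inner_outerNormal_tangent_eq_zero hΩ2 hγ hout hs0 hsf)

/-- There is a smooth vector field along the curve that points out of the obstacle at every contact
point, by a partition of unity. -/
theorem exists_contDiff_one_le_inner_outerNormal (hΩ : IsOpen Ω) (hΩ2 : HasC2Boundary Ω) {t : ℝ}
    {γ : ℝ → E3} (hγ : ContinuousOn γ (Icc 0 t)) :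
    ∃ w : ℝ → E3, ContDiff ℝ 1 w ∧
      ∀ s ∈ contactSet Ω t γ, 1 ≤ inner ℝ (outerNormal Ω (γ s)) (w s) := by
  have hcl : IsClosed (contactSet Ω t γ) :=
    hγ.preimage_isClosed_of_isClosed isClosed_Icc isClosed_frontier
  obtain ⟨g, hg⟩ := exists_contMDiffMap_forall_mem_convex_of_local_const (n := 1)
    (modelWithCornersSelf ℝ ℝ) (F := E3)
    (t := fun s : ℝ => {y : E3 | s ∈ contactSet Ω t γ → 1 ≤ inner ℝ (outerNormal Ω (γ s)) y})
    (fun s => by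
      intro y hy z hz a b ha hb hab hs
      rw [inner_add_right, real_inner_smul_right, real_inner_smul_right]
      have h1 := mul_le_mul_of_nonneg_left (hy hs) ha
      have h2 := mul_le_mul_of_nonneg_left (hz hs) hb
      linarith)
    (fun s => by
      by_cases hs : s ∈ contactSet Ω t γ
      · refine ⟨(2 : ℝ) • outerNormal Ω (γ s), ?_⟩
        have hc : ContinuousWithinAt (fun r => (inner ℝ (outerNormal Ω (γ r))
            ((2 : ℝ) • outerNormal Ω (γ s)) : ℝ)) (contactSet Ω t γ) s :=
          ((continuousOn_outerNormal_comp hΩ hΩ2 hγ).inner continuousOn_const) s hs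
        have h2 : 1 < (inner ℝ (outerNormal Ω (γ s)) ((2 : ℝ) • outerNormal Ω (γ s)) : ℝ) := by
          rw [real_inner_smul_right, real_inner_self_eq_norm_sq, norm_outerNormal hΩ2 hs.2]
          norm_num
        filter_upwards [eventually_nhdsWithin_iff.1 (hc.eventually_const_lt h2)] with r hr hrC
        exact (hr hrC).le
      · refine ⟨0, ?_⟩
        filter_upwards [hcl.isOpen_compl.mem_nhds hs] with r hr hrC
        exact absurd hrC hr)
  exact ⟨g, g.contMDiff.contDiff, hg⟩

end Normal

/-! ### Calculus for primitives of integrable functions -/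

theorem absolutelyContinuousOnInterval_const_add_integral {f : ℝ → ℝ} {a b : ℝ} (c : ℝ)
    (hf : IntervalIntegrable f volume a b) :
    AbsolutelyContinuousOnInterval (fun x => c + ∫ y in a..x, f y) a b :=
  ((LipschitzWith.const c).lipschitzOnWith (s := uIcc a b)).absolutelyContinuousOnInterval.add
    (hf.absolutelyContinuousOnInterval_intervalIntegral left_mem_uIcc)

/-- The product rule for the product of a scalar and a vector valued primitive. -/
theorem integral_smul_add_smul_of_primitive {f f' : ℝ → ℝ} {g g' : ℝ → E3} {a b : ℝ}
    (hf' : IntervalIntegrable f' volume a b) (hg' : IntervalIntegrable g' volume a b)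
    (hf : ∀ x ∈ uIcc a b, f x = f a + ∫ y in a..x, f' y)
    (hg : ∀ x ∈ uIcc a b, g x = g a + ∫ y in a..x, g' y) :
    ∫ x in a..b, (f' x • g x + f x • g' x) = f b • g b - f a • g a := by
  have hfc : ContinuousOn f (uIcc a b) := by
    refine ContinuousOn.congr ?_ hf
    exact (absolutelyContinuousOnInterval_const_add_integral _ hf').continuousOn
  have hgc : ContinuousOn g (uIcc a b) := by
    refine ContinuousOn.congr ?_ hg
    exact continuousOn_const.add (intervalIntegral.continuousOn_primitive_interval'
      hg' left_mem_uIcc)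
  have hint : IntervalIntegrable (fun x => f' x • g x + f x • g' x) volume a b :=
    (hf'.smul_continuousOn hgc).add (hg'.continuousOn_smul hfc)
  -- Absolute continuity of primitives is available for real functions, so test against `z`.
  refine ext_inner_left ℝ fun z => ?_
  have hz' : IntervalIntegrable (fun x => inner ℝ z (g' x)) volume a b :=
    ⟨hg'.1.const_inner z, hg'.2.const_inner z⟩
  have hz : ∀ x ∈ uIcc a b, inner ℝ z (g x) = inner ℝ z (g a) + ∫ y in a..x, inner ℝ z (g' y) := by
    intro x hx
    have hgx : IntervalIntegrable g' volume a x :=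
      hg'.mono_set (uIcc_subset_uIcc left_mem_uIcc hx)
    have h1 := (innerSL ℝ z).intervalIntegral_comp_comm hgx
    simp only [innerSL_apply_apply] at h1
    rw [h1, ← inner_add_right, ← hg x hx]
  have h2 := (innerSL ℝ z).intervalIntegral_comp_comm hint
  simp only [innerSL_apply_apply] at h2
  rw [← h2, inner_sub_right, real_inner_smul_right, real_inner_smul_right]
  have h3 := AbsolutelyContinuousOnInterval.integral_deriv_mul_eq_sub
    (absolutelyContinuousOnInterval_const_add_integral (f a) hf')
    (absolutelyContinuousOnInterval_const_add_integral (inner ℝ z (g a)) hz')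
  rw [← hf b right_mem_uIcc, ← hz b right_mem_uIcc, ← hf a left_mem_uIcc,
    ← hz a left_mem_uIcc] at h3
  rw [← h3]
  refine intervalIntegral.integral_congr_ae ?_
  filter_upwards [hf'.ae_hasDerivAt_integral, hz'.ae_hasDerivAt_integral] with x h4 h5 hx
  have hx' : x ∈ uIcc a b := uIoc_subset_uIcc hx
  rw [((h4 hx' a left_mem_uIcc).const_add (f a)).deriv,
    ((h5 hx' a left_mem_uIcc).const_add (inner ℝ z (g a))).deriv, ← hf x hx', ← hz x hx',
    inner_add_right, real_inner_smul_right, real_inner_smul_right]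

/-- A primitive of constant norm is almost everywhere orthogonal to its derivative. -/
theorem ae_inner_eq_zero_of_norm_eq_one {k κ : ℝ → E3} {t : ℝ} (ht : 0 ≤ t)
    (hκ : IntervalIntegrable κ volume 0 t)
    (hk : ∀ s ∈ Icc 0 t, k s = k 0 + ∫ σ in (0 : ℝ)..s, κ σ) (hk1 : ∀ s ∈ Icc 0 t, ‖k s‖ = 1) :
    ∀ᵐ s, s ∈ Ioo 0 t → inner ℝ (k s) (κ s) = 0 := by
  filter_upwards [hκ.ae_hasDerivAt_integral] with s hs hst
  have hev : ∀ᶠ r in 𝓝 s, r ∈ Icc 0 t := Icc_mem_nhds hst.1 hst.2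
  have hd : HasDerivAt k (κ s) s := by
    refine ((hs (by rw [uIcc_of_le ht]; exact Ioo_subset_Icc_self hst) 0
      left_mem_uIcc).const_add (k 0)).congr_of_eventuallyEq ?_
    filter_upwards [hev] with r hr using hk r hr
  have h1 : HasDerivAt (fun r => (inner ℝ (k r) (k r) : ℝ)) 0 s := by
    refine (hasDerivAt_const s (1 : ℝ)).congr_of_eventuallyEq ?_
    filter_upwards [hev] with r hr
    rw [real_inner_self_eq_norm_sq, hk1 r hr, one_pow]
  have h2 := (hd.inner ℝ hd).unique h1
  rw [real_inner_comm (k s) (κ s)] at h2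
  linarith

/-! ### Rotation fields and the velocities they generate -/

section Field

variable {t : ℝ} {γ : ℝ → E3} {Ω : Set E3}

/-- If `ω` is the derivative of a field `Ψ` of accumulated angular velocities, the velocity of the
curve is the primitive of `Ψ × k`, by integration by parts. -/
theorem velocity_eq_integral_cross_tangent (hγ : DifferentiableOn ℝ γ (Icc 0 t))
    (hk : ContinuousOn (tangent t γ) (Icc 0 t)) {Ψ : ℝ → E3} (hΨ : ContDiff ℝ 1 Ψ) (hΨ0 : Ψ 0 = 0)
    {ω : AngularVelocity t} (hω : ω =ᵐ[volume.restrict (Icc 0 t)] deriv Ψ) {s : ℝ}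
    (hs : s ∈ Icc 0 t) :
    velocity γ ω s = ∫ σ in (0 : ℝ)..s, cross (Ψ σ) (tangent t γ σ) := by
  have hsub : Icc 0 s ⊆ Icc 0 t := Icc_subset_Icc_right hs.2
  have hΨ' : Continuous (deriv Ψ) := hΨ.continuous_deriv le_rfl
  have hγs : ContinuousOn (fun σ => γ s - γ σ) (Icc 0 s) :=
    continuousOn_const.sub (hγ.continuousOn.mono hsub)
  have h1 : velocity γ ω s = ∫ σ in (0 : ℝ)..s, cross (deriv Ψ σ) (γ s - γ σ) := by
    refine intervalIntegral_congr_of_ae_restrict hs ?_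
    filter_upwards [hω] with σ hσ
    rw [hσ]
  have hi1 : IntervalIntegrable (fun σ => cross (deriv Ψ σ) (γ s - γ σ)) volume 0 s :=
    intervalIntegrable_cross (hΨ'.intervalIntegrable _ _) (by rwa [uIcc_of_le hs.1])
  have hi2 : IntervalIntegrable (fun σ => cross (Ψ σ) (tangent t γ σ)) volume 0 s :=
    intervalIntegrable_cross (hΨ.continuous.intervalIntegrable _ _)
      (by rw [uIcc_of_le hs.1]; exact hk.mono hsub)
  have hftc := intervalIntegral.integral_eq_sub_of_hasDerivAt_of_le hs.1
    (f := fun σ => cross (Ψ σ) (γ s - γ σ))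
    (f' := fun σ => cross (deriv Ψ σ) (γ s - γ σ) - cross (Ψ σ) (tangent t γ σ))
    ((crossL.continuous.comp_continuousOn hΨ.continuous.continuousOn).clm_apply hγs)
    (fun σ hσ => by
      have hdΨ : HasDerivAt Ψ (deriv Ψ σ) σ :=
        (hΨ.differentiable (by norm_num) σ).hasDerivAt
      have hdγ : HasDerivAt (fun σ => γ s - γ σ) (-tangent t γ σ) σ :=
        (hasDerivAt_tangent hγ ⟨hσ.1, hσ.2.trans_le hs.2⟩).const_sub (γ s)
      have := (crossL.hasFDerivAt.comp_hasDerivAt σ hdΨ).clm_apply hdγ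
      simpa only [Function.comp, crossL_apply, map_neg, ← sub_eq_add_neg] using this)
    (hi1.sub hi2)
  rw [intervalIntegral.integral_sub hi1 hi2] at hftc
  rw [h1, sub_eq_zero.1 (hftc.trans _)]
  simp only [← crossL_apply, sub_self, map_zero, hΨ0, zero_apply]

/-- An integrable rotation field `Φ`, zero up to `a'`, whose velocity satisfies the obstacle constraints with a margin
`δ` can be replaced by a smooth one, which is the primitive of an admissible angular velocity. -/
theorem admissible_nonempty_of_rotationField (hΩ2 : HasC2Boundary Ω)
    (hγ : DifferentiableOn ℝ γ (Icc 0 t)) (hk : ContinuousOn (tangent t γ) (Icc 0 t))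
    (hk1 : ∀ s ∈ Icc 0 t, ‖tangent t γ s‖ = 1) {a a' δ : ℝ} (ha : 0 ≤ a) (haa' : a < a')
    (hδ : 0 < δ) {Φ : ℝ → E3} (hΦ : IntervalIntegrable Φ volume 0 t) (hΦ0 : ∀ s ≤ a', Φ s = 0)
    (hcontact : ∀ s ∈ Ioc a t, γ s ∈ frontier Ω →
      δ ≤ inner ℝ (outerNormal Ω (γ s)) (∫ σ in (0 : ℝ)..s, cross (Φ σ) (tangent t γ σ)))
    (ht : 0 < t)
    (htip : γ t ∈ frontier Ω → δ ≤ inner ℝ (outerNormal Ω (γ t))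
      (tangent t γ t + ∫ σ in (0 : ℝ)..t, cross (Φ σ) (tangent t γ σ))) :
    (admissible Ω t γ).Nonempty := by
  have hΦI : Integrable (indicator (Ioc 0 t) Φ) :=
    (integrable_indicator_iff measurableSet_Ioc).2
      ((intervalIntegrable_iff_integrableOn_Ioc_of_le ht.le).1 hΦ)
  obtain ⟨g, hgs, hg, hfg⟩ := (memLp_one_iff_integrable.2 hΦI).exist_eLpNorm_sub_le
    ENNReal.one_ne_top le_rfl hδ
  have hgI : Integrable g := hg.continuous.integrable_of_hasCompactSupport hgs
  -- Multiplying by the cutoff `χ` makes the approximation vanish on `[0, a]`.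
  set χ : ℝ → ℝ := fun s => Real.smoothTransition ((s - a) / (a' - a)) with hχ
  have hχd : ContDiff ℝ 1 χ := Real.smoothTransition.contDiff.comp (by fun_prop)
  have hχ0 : ∀ s ≤ a, χ s = 0 := fun s hs =>
    Real.smoothTransition.zero_of_nonpos (div_nonpos_of_nonpos_of_nonneg (by linarith)
      (by linarith))
  have hχ1 : ∀ s, a' ≤ s → χ s = 1 := fun s hs =>
    Real.smoothTransition.one_of_one_le ((one_le_div (by linarith)).2 (by linarith))
  set Ψ : ℝ → E3 := fun s => χ s • g s with hΨdef
  have hΨ : ContDiff ℝ 1 Ψ := hχd.smul (hg.of_le (by exact_mod_cast le_top))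
  have hΨ0 : ∀ s ≤ a, Ψ s = 0 := fun s hs => by simp [hΨdef, hχ0 s hs]
  have hmem : MemLp (deriv Ψ) 2 (volume.restrict (Icc (0 : ℝ) t)) := by
    have hc : Continuous (deriv Ψ) := hΨ.continuous_deriv le_rfl
    obtain ⟨B, hB⟩ := (isCompact_Icc (a := (0 : ℝ)) (b := t)).exists_bound_of_continuousOn
      hc.continuousOn
    exact MemLp.of_bound hc.aestronglyMeasurable B (ae_restrict_of_forall_mem measurableSet_Icc hB)
  have hvel : ∀ s ∈ Icc 0 t, velocity γ hmem.toLp s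
      = ∫ σ in (0 : ℝ)..s, cross (Ψ σ) (tangent t γ σ) := fun s hs =>
    velocity_eq_integral_cross_tangent hγ hk hΨ (hΨ0 0 ha) hmem.coeFn_toLp hs
  have hclose : ∀ s ∈ Icc 0 t, ‖velocity γ hmem.toLp s
      - ∫ σ in (0 : ℝ)..s, cross (Φ σ) (tangent t γ σ)‖ ≤ δ := by
    intro s hs
    have hks : ContinuousOn (tangent t γ) (uIcc 0 s) := by
      rw [uIcc_of_le hs.1]
      exact hk.mono (Icc_subset_Icc_right hs.2)
    have hΦs : IntervalIntegrable Φ volume 0 s := hΦ.mono_set (by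
      rw [uIcc_of_le hs.1, uIcc_of_le ht.le]
      exact Icc_subset_Icc_right hs.2)
    rw [hvel s hs, ← intervalIntegral.integral_sub
      (intervalIntegrable_cross (hΨ.continuous.intervalIntegrable _ _) hks)
      (intervalIntegrable_cross hΦs hks)]
    have hD : Integrable (fun σ => ‖indicator (Ioc 0 t) Φ σ - g σ‖) := (hΦI.sub hgI).norm
    calc _ ≤ ∫ σ in (0 : ℝ)..s, ‖indicator (Ioc 0 t) Φ σ - g σ‖ := by
          refine intervalIntegral.norm_integral_le_of_norm_le hs.1 ?_ hD.intervalIntegrable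
          refine Eventually.of_forall fun σ hσ => ?_
          have hσt : σ ∈ Ioc 0 t := ⟨hσ.1, hσ.2.trans hs.2⟩
          have h1 := norm_cross_le (Ψ σ - Φ σ) (tangent t γ σ)
          rw [hk1 σ (Ioc_subset_Icc_self hσt), mul_one] at h1
          simp only [← crossL_apply, map_sub, sub_apply] at h1 ⊢
          refine h1.trans ?_
          rw [indicator_of_mem hσt]
          rcases le_total a' σ with hle | hle
          · simp only [hΨdef, hχ1 σ hle, one_smul]
            exact (norm_sub_rev _ _).le
          · rw [hΦ0 σ hle, sub_zero, zero_sub, norm_neg, hΨdef, norm_smul]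
            refine mul_le_of_le_one_left (norm_nonneg _) ?_
            rw [Real.norm_of_nonneg (Real.smoothTransition.nonneg _)]
            exact Real.smoothTransition.le_one _
      _ ≤ ∫ σ, ‖indicator (Ioc 0 t) Φ σ - g σ‖ := by
          rw [intervalIntegral.integral_of_le hs.1]
          exact setIntegral_le_integral hD (Eventually.of_forall fun σ => norm_nonneg _)
      _ ≤ δ := by
          have h2 : ∫ σ, ‖indicator (Ioc 0 t) Φ σ - g σ‖
              = (eLpNorm (indicator (Ioc 0 t) Φ - g) 1 volume).toReal := by
            rw [eLpNorm_one_eq_lintegral_enorm]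
            exact integral_norm_eq_lintegral_enorm (hΦI.sub hgI).aestronglyMeasurable
          rw [h2]
          exact ENNReal.toReal_le_of_le_ofReal hδ.le hfg
  have hinner : ∀ s ∈ Icc 0 t, γ s ∈ frontier Ω → inner ℝ (outerNormal Ω (γ s))
      (∫ σ in (0 : ℝ)..s, cross (Φ σ) (tangent t γ σ)) - δ
        ≤ inner ℝ (outerNormal Ω (γ s)) (velocity γ hmem.toLp s) := by
    intro s hs hsf
    have h1 := abs_real_inner_le_norm (outerNormal Ω (γ s)) (velocity γ hmem.toLp s
      - ∫ σ in (0 : ℝ)..s, cross (Φ σ) (tangent t γ σ))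
    rw [norm_outerNormal hΩ2 hsf, one_mul, inner_sub_right] at h1
    linarith [(abs_le.1 (h1.trans (hclose s hs))).1]
  refine ⟨hmem.toLp, fun s hs hsf => ?_, fun hf => ?_⟩
  · rcases le_or_gt s a with hsa | hsa
    · have h0 : ∫ σ in (0 : ℝ)..s, cross (Ψ σ) (tangent t γ σ) = 0 := by
        refine intervalIntegral.integral_zero_ae (Eventually.of_forall fun σ hσ => ?_)
        rw [uIoc_of_le hs.1] at hσ
        rw [hΨ0 σ (hσ.2.trans hsa), ← crossL_apply, map_zero, zero_apply]
      rw [hvel s hs, h0, inner_zero_right]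
    · linarith [hinner s hs hsf, hcontact s ⟨hsa, hs.2⟩ hsf]
  · have h1 := hinner t ⟨ht.le, le_rfl⟩ hf
    have h2 := htip hf
    rw [tipVelocity_eq, inner_add_right]
    rw [inner_add_right] at h2
    linarith

end Field

/-! ### Velocities generated by bending -/

/-- The operator `z ↦ ∫ (k × z) × k` on vectors is injective unless the unit field `k` is constant:
its quadratic form integrates `‖z‖² - ⟨k, z⟩²`. -/
theorem eq_left_of_integral_cross_cross_eq_zero {k : ℝ → E3} {a b : ℝ} (hab : a < b)
    (hk : ContinuousOn k (Icc a b)) (hk1 : ∀ s ∈ Icc a b, ‖k s‖ = 1) {z : E3} (hz : z ≠ 0)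
    (h0 : ∫ s in a..b, cross (cross (k s) z) (k s) = 0) : ∀ s ∈ Icc a b, k s = k a := by
  have hz' : 0 < ‖z‖ := norm_pos_iff.2 hz
  have hinner : ContinuousOn (fun s => (inner ℝ (k s) z : ℝ)) (Icc a b) :=
    hk.inner continuousOn_const
  have hI : ∫ s in a..b, (‖z‖ ^ 2 - (inner ℝ (k s) z : ℝ) ^ 2) = 0 := by
    have hci : IntervalIntegrable (fun s => cross (cross (k s) z) (k s)) volume a b := by
      refine ContinuousOn.intervalIntegrable ?_
      rw [uIcc_of_le hab.le]
      exact (crossL.continuous.comp_continuousOn ((crossL.continuous.comp_continuousOn hk).clm_apply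
        continuousOn_const)).clm_apply hk
    have h1 := (innerSL ℝ z).intervalIntegral_comp_comm hci
    rw [h0, map_zero] at h1
    rw [← h1]
    refine intervalIntegral.integral_congr fun s hs => ?_
    rw [uIcc_of_le hab.le] at hs
    simp only [innerSL_apply_apply]
    rw [cross_cross_of_norm_eq_one (hk1 s hs), inner_sub_right, real_inner_smul_right,
      real_inner_self_eq_norm_sq, real_inner_comm z (k s)]
    ring
  have hcs : ∀ s ∈ Icc a b, (inner ℝ (k s) z : ℝ) ^ 2 ≤ ‖z‖ ^ 2 := by
    intro s hs
    have := abs_real_inner_le_norm (k s) z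
    rw [hk1 s hs, one_mul] at this
    exact sq_le_sq' (abs_le.1 this).1 (abs_le.1 this).2
  have hsq : ∀ s ∈ Icc a b, (inner ℝ (k s) z : ℝ) ^ 2 = ‖z‖ ^ 2 := by
    by_contra! hcon
    obtain ⟨c, hc, hne⟩ := hcon
    have := intervalIntegral.integral_pos hab
      (f := fun s => ‖z‖ ^ 2 - (inner ℝ (k s) z : ℝ) ^ 2)
      (continuousOn_const.sub (hinner.pow 2))
      (fun s hs => sub_nonneg.2 (hcs s (Ioc_subset_Icc_self hs)))
      ⟨c, hc, sub_pos.2 (lt_of_le_of_ne (hcs c hc) hne)⟩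
    exact this.ne' hI
  have hend : ∀ s ∈ Icc a b, ∀ y : E3, ‖y‖ = ‖z‖ → (inner ℝ (k s) y : ℝ) = ‖z‖ →
      k s = ‖z‖⁻¹ • y := by
    intro s hs y hy hsy
    have h1 := (inner_eq_norm_mul_iff_real (x := k s) (y := y)).1
      (by rw [hsy, hk1 s hs, hy, one_mul])
    rw [hk1 s hs, one_smul, hy] at h1
    rw [← h1, smul_smul, inv_mul_cancel₀ hz'.ne', one_smul]
  have ha : a ∈ Icc a b := left_mem_Icc.2 hab.le
  rcases isPreconnected_Icc.eq_or_eq_neg_of_sq_eq hinner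
    (continuousOn_const (c := ‖z‖)) (fun s hs => hsq s hs) (fun _ => hz'.ne') with h | h
  · intro s hs
    rw [hend s hs z rfl (h hs), hend a ha z rfl (h ha)]
  · have hneg : ∀ s ∈ Icc a b, k s = ‖z‖⁻¹ • (-z) := fun s hs =>
      hend s hs (-z) (norm_neg z) (by
        have := h hs
        simp only [Pi.neg_apply] at this
        rw [inner_neg_right, this, neg_neg])
    intro s hs
    rw [hneg s hs, hneg a ha]

/-- Along a nonconstant field `k` of unit vectors, rotations generate every velocity. -/
theorem exists_integral_cross_cross_eq {k : ℝ → E3} {a b : ℝ} (hab : a < b)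
    (hk : ContinuousOn k (Icc a b)) (hk1 : ∀ s ∈ Icc a b, ‖k s‖ = 1)
    (hne : ∃ s ∈ Icc a b, k s ≠ k a) (v : E3) :
    ∃ z, ∫ s in a..b, cross (cross (k s) z) (k s) = v := by
  have hci : ∀ z, IntervalIntegrable (fun s => cross (cross (k s) z) (k s)) volume a b := by
    intro z
    refine ContinuousOn.intervalIntegrable ?_
    rw [uIcc_of_le hab.le]
    exact (crossL.continuous.comp_continuousOn ((crossL.continuous.comp_continuousOn hk).clm_apply
      continuousOn_const)).clm_apply hk
  let T : E3 →ₗ[ℝ] E3 :=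
    { toFun := fun z => ∫ s in a..b, cross (cross (k s) z) (k s)
      map_add' := fun y z => by
        rw [← intervalIntegral.integral_add (hci y) (hci z)]
        simp only [← crossL_apply, map_add, add_apply]
      map_smul' := fun c z => by
        rw [RingHom.id_apply, ← intervalIntegral.integral_smul]
        simp only [← crossL_apply, map_smul, smul_apply] }
  have hinj : Function.Injective T := by
    rw [← LinearMap.ker_eq_bot, LinearMap.ker_eq_bot']
    intro z hz
    by_contra hz0
    obtain ⟨s, hs, hks⟩ := hne
    exact hks (eq_left_of_integral_cross_cross_eq_zero hab hk hk1 hz0 hz s hs)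
  exact LinearMap.injective_iff_surjective.1 hinj v

/-! ### Existence of admissible angular velocities -/

section Admissible

variable {t : ℝ} {γ : ℝ → E3} {Ω : Set E3}

/-- A tip that hits the obstacle obliquely can be turned away by bending the curve near the tip. -/
theorem admissible_nonempty_of_tangent_ne_neg (hΩ : IsOpen Ω) (hΩ2 : HasC2Boundary Ω) (ht : 0 < t)
    (hγ : DifferentiableOn ℝ γ (Icc 0 t)) (hk : ContinuousOn (tangent t γ) (Icc 0 t))
    (hk1 : ∀ s ∈ Icc 0 t, ‖tangent t γ s‖ = 1) (hout : ∀ s ∈ Icc 0 t, γ s ∉ Ω)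
    (htf : γ t ∈ frontier Ω) (htr : inner ℝ (outerNormal Ω (γ t)) (tangent t γ t) < 0)
    (hne : tangent t γ t ≠ -outerNormal Ω (γ t)) : (admissible Ω t γ).Nonempty := by
  have htt : t ∈ Icc 0 t := ⟨ht.le, le_rfl⟩
  obtain ⟨c, hc, hcf⟩ := exists_forall_notMem_frontier hΩ hΩ2 ht hγ hk hout htf htr.ne
  set n := outerNormal Ω (γ t) with hn
  have hn1 : ‖n‖ = 1 := norm_outerNormal hΩ2 htf
  have hkt1 := hk1 t htt
  set e := cross (tangent t γ t) n with he
  have hlow : -1 < inner ℝ n (tangent t γ t) := by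
    have h1 : inner ℝ (-n) (tangent t γ t) < 1 :=
      (inner_lt_one_iff_real_of_norm_eq_one (by rw [norm_neg, hn1]) hkt1).2 hne.symm
    rw [inner_neg_left] at h1
    linarith
  set u : ℝ → ℝ := fun s => inner ℝ n (cross e (tangent t γ s)) with hu
  have huc : ContinuousOn u (Icc 0 t) :=
    continuousOn_const.inner ((crossL e).continuous.comp_continuousOn hk)
  have hut : 0 < u t := by
    simp only [hu, he]
    rw [cross_cross_of_norm_eq_one hkt1, inner_sub_right, real_inner_smul_right,
      real_inner_self_eq_norm_sq, hn1, real_inner_comm n]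
    nlinarith
  have hev := eventually_nhdsWithin_iff.1 ((huc t htt).eventually_const_lt hut)
  obtain ⟨d, hd, hdu⟩ := exists_Ioc_subset_of_mem_nhds' hev hc.2
  -- The rotation field is constant on `(a', t]`, and `(d, t)` contains no contact point.
  set a' := (d + t) / 2 with ha'
  have hd0 : 0 ≤ d := hc.1.trans hd.1
  have hda' : d < a' := by rw [ha']; linarith [hd.2]
  have ha't : a' < t := by rw [ha']; linarith [hd.2]
  have hsub : Icc a' t ⊆ Icc 0 t := Icc_subset_Icc_left (hd0.trans hda'.le)
  have hIpos : 0 < ∫ s in a'..t, u s := by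
    refine intervalIntegral.intervalIntegral_pos_of_pos_on
      (ContinuousOn.intervalIntegrable (by rw [uIcc_of_le ha't.le]; exact huc.mono hsub))
      (fun s hs => ?_) ha't
    exact hdu ⟨hda'.trans hs.1, hs.2.le⟩ (hsub (Ioo_subset_Icc_self hs))
  set I := ∫ s in a'..t, u s with hI
  set Φ : ℝ → E3 := fun s => if s ≤ a' then 0 else (2 / I) • e with hΦdef
  have hΦ : ∀ r r', IntervalIntegrable Φ volume r r' := by
    intro r r'
    rw [intervalIntegrable_iff]
    refine Measure.integrableOn_of_bounded (M := ‖(2 / I) • e‖) (by simp) ?_ ?_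
    · exact (Measurable.ite measurableSet_Iic measurable_const
        measurable_const).aestronglyMeasurable
    · refine Eventually.of_forall fun s => ?_
      simp only [hΦdef]
      split_ifs <;> simp
  have hV : inner ℝ n (∫ σ in (0 : ℝ)..t, cross (Φ σ) (tangent t γ σ)) = 2 := by
    have hci : ∀ r ∈ Icc 0 t, ∀ r' ∈ Icc 0 t,
        IntervalIntegrable (fun σ => cross (Φ σ) (tangent t γ σ)) volume r r' :=
      fun r hr r' hr' => intervalIntegrable_cross (hΦ r r')
        (hk.mono (ordConnected_Icc.uIcc_subset hr hr'))
    have h00 : (0 : ℝ) ∈ Icc 0 t := ⟨le_rfl, ht.le⟩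
    have ha'm : a' ∈ Icc 0 t := hsub ⟨le_rfl, ha't.le⟩
    rw [← intervalIntegral.integral_add_adjacent_intervals (hci 0 h00 a' ha'm) (hci a' ha'm t htt)]
    have h1 : ∫ σ in (0 : ℝ)..a', cross (Φ σ) (tangent t γ σ) = 0 := by
      refine intervalIntegral.integral_zero_ae (Eventually.of_forall fun σ hσ => ?_)
      rw [uIoc_of_le ha'm.1] at hσ
      simp only [hΦdef, if_pos hσ.2, ← crossL_apply, map_zero, zero_apply]
    have h2 := (innerSL ℝ n).intervalIntegral_comp_comm (hci a' ha'm t htt)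
    simp only [innerSL_apply_apply] at h2
    rw [h1, zero_add, ← h2]
    have h3 : ∫ σ in a'..t, inner ℝ n (cross (Φ σ) (tangent t γ σ)) = ∫ σ in a'..t, 2 / I * u σ := by
      refine intervalIntegral.integral_congr_ae (Eventually.of_forall fun σ hσ => ?_)
      rw [uIoc_of_le ha't.le] at hσ
      simp only [hΦdef, if_neg (not_le.2 hσ.1), hu]
      simp only [← crossL_apply, map_smul, smul_apply, real_inner_smul_right]
    rw [h3, intervalIntegral.integral_const_mul, ← hI, div_mul_cancel₀ _ hIpos.ne']
  refine admissible_nonempty_of_rotationField (δ := 1) (Φ := Φ) hΩ2 hγ hk hk1 hd0 hda' one_pos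
    (hΦ 0 t) (fun s hs => if_pos hs) (fun s hs hsf => ?_) ht fun _ => ?_
  · rcases hs.2.eq_or_lt with rfl | hst
    · rw [← hn, hV]
      norm_num
    · exact absurd hsf (hcf s ⟨hd.1.trans_lt hs.1, hst⟩)
  · rw [← hn, inner_add_right, hV]
    linarith

/-- If the tip hits the obstacle perpendicularly but the curve bends somewhere away from the
obstacle, rotations in the bend can produce any velocity at its end. This allows the rest of the
curve to be withdrawn backwards along itself while a field `w` pushes it off the obstacle: beyond
the bend the velocity is `w - μ k`. At the contact points `w` points outwards and `k` is tangent to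
the boundary; at the tip both `w` and `-k` point outwards. -/
theorem admissible_nonempty_of_bend (hΩ : IsOpen Ω) (hΩ2 : HasC2Boundary Ω) (ht : 0 < t)
    (hγ : DifferentiableOn ℝ γ (Icc 0 t)) {κ : ℝ → E3} (hκ : IntervalIntegrable κ volume 0 t)
    (hκk : ∀ s ∈ Icc 0 t, tangent t γ s = tangent t γ 0 + ∫ σ in (0 : ℝ)..s, κ σ)
    (hk : ContinuousOn (tangent t γ) (Icc 0 t))
    (hk1 : ∀ s ∈ Icc 0 t, ‖tangent t γ s‖ = 1) (hout : ∀ s ∈ Icc 0 t, γ s ∉ Ω)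
    (htf : γ t ∈ frontier Ω) (hperp : tangent t γ t = -outerNormal Ω (γ t))
    {a a' b : ℝ} (ha : 0 ≤ a) (haa' : a < a') (hab : a' < b) (hbt : b < t)
    (hfree : ∀ s ∈ Icc a b, γ s ∉ frontier Ω)
    (hbend : ∃ s ∈ Icc a' b, tangent t γ s ≠ tangent t γ a') :
    (admissible Ω t γ).Nonempty := by
  have htt : t ∈ Icc 0 t := ⟨ht.le, le_rfl⟩
  have h00 : (0 : ℝ) ∈ Icc 0 t := ⟨le_rfl, ht.le⟩
  have ha't : a' ∈ Icc 0 t := ⟨by linarith, by linarith⟩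
  have hbm : b ∈ Icc 0 t := ⟨by linarith, by linarith⟩
  have huI : ∀ {r r' : ℝ}, r ∈ Icc 0 t → r' ∈ Icc 0 t → uIcc r r' ⊆ Icc 0 t :=
    fun hr hr' => ordConnected_Icc.uIcc_subset hr hr'
  have huI' : ∀ {r r' : ℝ}, r ∈ Icc 0 t → r' ∈ Icc 0 t → uIcc r r' ⊆ uIcc 0 t :=
    fun hr hr' => by rw [uIcc_of_le ht.le]; exact huI hr hr'
  obtain ⟨w, hw, hwn⟩ := exists_contDiff_one_le_inner_outerNormal hΩ hΩ2 hγ.continuousOn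
  have hw' : Continuous (deriv w) := hw.continuous_deriv le_rfl
  set k := tangent t γ with hkdef
  set n := outerNormal Ω (γ t) with hn
  have hn1 : ‖n‖ = 1 := norm_outerNormal hΩ2 htf
  set μ' : ℝ → ℝ := fun s => inner ℝ (k s) (deriv w s) with hμ'
  have hμ'c : ContinuousOn μ' (Icc 0 t) := hk.inner hw'.continuousOn
  -- The constant of integration makes `μ t = 1`.
  set μ : ℝ → ℝ := fun s => (1 - ∫ σ in b..t, μ' σ) + ∫ σ in b..s, μ' σ with hμ
  have hμb : μ b = 1 - ∫ σ in b..t, μ' σ := by simp [hμ]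
  have hμt : μ t = 1 := by simp [hμ]
  have hμ'i : ∀ {r r' : ℝ}, r ∈ Icc 0 t → r' ∈ Icc 0 t → IntervalIntegrable μ' volume r r' :=
    fun hr hr' => (hμ'c.mono (huI hr hr')).intervalIntegrable
  have hκi : ∀ {r r' : ℝ}, r ∈ Icc 0 t → r' ∈ Icc 0 t → IntervalIntegrable κ volume r r' :=
    fun hr hr' => hκ.mono_set (huI' hr hr')
  have hμc : ContinuousOn μ (Icc b t) := by
    have := intervalIntegral.continuousOn_primitive_interval' (hμ'i hbm htt) left_mem_uIcc
    rw [uIcc_of_le hbt.le] at this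
    exact continuousOn_const.add this
  obtain ⟨z, hz⟩ := exists_integral_cross_cross_eq hab (hk.mono (Icc_subset_Icc ha't.1 hbm.2))
    (fun s hs => hk1 s ⟨ha't.1.trans hs.1, hs.2.trans hbm.2⟩) hbend (w b - μ b • k b)
  set Φ : ℝ → E3 := fun s => if s ≤ a' then 0 else if s ≤ b then cross (k s) z
    else cross (k s) (deriv w s - μ s • κ s) with hΦdef
  have hΦ1 : EqOn Φ (fun _ => 0) (uIoc 0 a') := fun s hs => by
    rw [uIoc_of_le ha't.1] at hs
    simp only [hΦdef, if_pos hs.2]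
  have hΦ2 : EqOn Φ (fun s => cross (k s) z) (uIoc a' b) := fun s hs => by
    rw [uIoc_of_le hab.le] at hs
    simp only [hΦdef, if_neg (not_le.2 hs.1), if_pos hs.2]
  have hΦ3 : ∀ r, b ≤ r → EqOn Φ (fun s => cross (k s) (deriv w s - μ s • κ s)) (uIoc b r) :=
    fun r hr s hs => by
      rw [uIoc_of_le hr] at hs
      simp only [hΦdef, if_neg (not_le.2 (hab.trans hs.1)), if_neg (not_le.2 hs.1)]
  have hcont3 : ∀ r ∈ Icc b t, IntervalIntegrable (fun s => deriv w s - μ s • κ s) volume b r := by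
    intro r hr
    refine (hw'.intervalIntegrable _ _).sub
      ((hκi hbm ⟨hbm.1.trans hr.1, hr.2⟩).continuousOn_smul (hμc.mono ?_))
    rw [uIcc_of_le hr.1]
    exact Icc_subset_Icc_right hr.2
  have hΦi1 : IntervalIntegrable Φ volume 0 a' :=
    (intervalIntegrable_const (c := (0 : E3))).congr hΦ1.symm
  have hΦi2 : IntervalIntegrable Φ volume a' b := by
    refine IntervalIntegrable.congr hΦ2.symm ?_
    refine ContinuousOn.intervalIntegrable ?_
    exact (crossL.continuous.comp_continuousOn (hk.mono (huI ha't hbm))).clm_apply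
      continuousOn_const
  have hΦi3 : ∀ r ∈ Icc b t, IntervalIntegrable Φ volume b r := by
    intro r hr
    refine IntervalIntegrable.congr (hΦ3 r hr.1).symm ?_
    have := (intervalIntegrable_cross (hcont3 r hr)
      (hk.mono (huI hbm ⟨hbm.1.trans hr.1, hr.2⟩))).neg
    refine this.congr fun s _ => ?_
    simp only [Pi.neg_apply, neg_cross]
  have horth := ae_inner_eq_zero_of_norm_eq_one ht.le hκ hκk hk1
  -- Beyond the bend, the velocity generated by `Φ` is `w - μ k`.
  have hV : ∀ s ∈ Icc b t, ∫ σ in (0 : ℝ)..s, cross (Φ σ) (k σ) = w s - μ s • k s := by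
    intro s hs
    have hsm : s ∈ Icc 0 t := ⟨hbm.1.trans hs.1, hs.2⟩
    have hi1 := intervalIntegrable_cross hΦi1 (hk.mono (huI h00 ha't))
    have hi2 := intervalIntegrable_cross hΦi2 (hk.mono (huI ha't hbm))
    have hi3 := intervalIntegrable_cross (hΦi3 s hs) (hk.mono (huI hbm hsm))
    rw [← intervalIntegral.integral_add_adjacent_intervals (hi1.trans hi2) hi3,
      ← intervalIntegral.integral_add_adjacent_intervals hi1 hi2]
    have e1 : ∫ σ in (0 : ℝ)..a', cross (Φ σ) (k σ) = 0 := by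
      refine intervalIntegral.integral_zero_ae (Eventually.of_forall fun σ hσ => ?_)
      rw [hΦ1 hσ]
      simp only [← crossL_apply, map_zero, zero_apply]
    have e2 : ∫ σ in a'..b, cross (Φ σ) (k σ) = w b - μ b • k b := by
      rw [← hz]
      refine intervalIntegral.integral_congr_ae (Eventually.of_forall fun σ hσ => ?_)
      rw [hΦ2 hσ]
    have e3 : ∫ σ in b..s, cross (Φ σ) (k σ)
        = ∫ σ in b..s, (deriv w σ - (μ' σ • k σ + μ σ • κ σ)) := by
      refine intervalIntegral.integral_congr_ae ?_
      have hst : ∀ᵐ σ : ℝ, σ ≠ t := by simp [ae_iff, measure_singleton]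
      filter_upwards [horth, hst] with σ h1 h2 hσ
      rw [hΦ3 s hs.1 hσ]
      rw [uIoc_of_le hs.1] at hσ
      have hσ0 : σ ∈ Ioo 0 t :=
        ⟨hbm.1.trans_lt hσ.1, lt_of_le_of_ne (hσ.2.trans hs.2) h2⟩
      rw [cross_cross_of_norm_eq_one (hk1 σ (Ioo_subset_Icc_self hσ0)), inner_sub_right,
        real_inner_smul_right, h1 hσ0, mul_zero, sub_zero]
      simp only [hμ']
      abel
    have hks : ∀ x ∈ uIcc b s, k x = k b + ∫ σ in b..x, κ σ := by
      intro x hx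
      have hxm := huI hbm hsm hx
      rw [hκk x hxm, hκk b hbm, add_assoc,
        intervalIntegral.integral_add_adjacent_intervals (hκi h00 hbm) (hκi hbm hxm)]
    have hprod := integral_smul_add_smul_of_primitive (hμ'i hbm hsm) (hκi hbm hsm)
      (f := μ) (fun x _ => by rw [hμb]) hks
    have hint : IntervalIntegrable (fun σ => μ' σ • k σ + μ σ • κ σ) volume b s := by
      refine ((hμ'i hbm hsm).smul_continuousOn (hk.mono (huI hbm hsm))).add
        ((hκi hbm hsm).continuousOn_smul (hμc.mono ?_))
      rw [uIcc_of_le hs.1]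
      exact Icc_subset_Icc_right hs.2
    rw [e1, e2, e3, intervalIntegral.integral_sub (hw'.intervalIntegrable _ _) hint, hprod,
      intervalIntegral.integral_deriv_eq_sub
        (fun x _ => hw.differentiable (by norm_num) x) (hw'.intervalIntegrable _ _)]
    abel
  have hVt : 2 ≤ inner ℝ n (∫ σ in (0 : ℝ)..t, cross (Φ σ) (k σ)) := by
    rw [hV t ⟨hbt.le, le_rfl⟩, hμt, one_smul, hperp, inner_sub_right, inner_neg_right,
      real_inner_self_eq_norm_sq, hn1]
    linarith [hwn t ⟨htt, htf⟩]
  refine admissible_nonempty_of_rotationField (δ := 1) (Φ := Φ) hΩ2 hγ hk hk1 ha haa' one_pos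
    ((hΦi1.trans hΦi2).trans (hΦi3 t ⟨hbt.le, le_rfl⟩)) (fun s hs => if_pos hs)
    (fun s hs hsf => ?_) ht fun _ => ?_
  · rcases hs.2.eq_or_lt with rfl | hst
    · exact (by norm_num : (1 : ℝ) ≤ 2).trans hVt
    · have hsb : b < s := by
        by_contra hle
        exact hfree s ⟨hs.1.le, not_lt.1 hle⟩ hsf
      have hs0 : s ∈ Ioo 0 t := ⟨hbm.1.trans_lt hsb, hst⟩
      rw [← hkdef, hV s ⟨hsb.le, hs.2⟩, inner_sub_right, real_inner_smul_right,
        inner_outerNormal_tangent_eq_zero hΩ2 hγ hout hs0 hsf, mul_zero, sub_zero]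
      exact hwn s ⟨Ioo_subset_Icc_self hs0, hsf⟩
  · rw [← hn, ← hkdef, inner_add_right]
    have hlow : inner ℝ n (k t) = -1 := by
      rw [hperp, inner_neg_right, real_inner_self_eq_norm_sq, hn1, one_pow]
    linarith

/-- Outside of breakdown configurations the obstacle constraints can be met. -/
theorem admissible_nonempty (hΩ : IsOpen Ω) (hΩ2 : HasC2Boundary Ω) (ht : 0 < t)
    (hγ : DifferentiableOn ℝ γ (Icc 0 t)) {κ : ℝ → E3} (hκ : IntervalIntegrable κ volume 0 t)
    (hκk : ∀ s ∈ Icc 0 t, tangent t γ s = tangent t γ 0 + ∫ σ in (0 : ℝ)..s, κ σ)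
    (hk : ContinuousOn (tangent t γ) (Icc 0 t))
    (hk1 : ∀ s ∈ Icc 0 t, ‖tangent t γ s‖ = 1) (hout : ∀ s ∈ Icc 0 t, γ s ∉ Ω)
    (hbreak : ¬ IsBreakdown Ω t γ) : (admissible Ω t γ).Nonempty := by
  by_cases hzero : γ t ∈ frontier Ω → 0 ≤ inner ℝ (outerNormal Ω (γ t)) (tangent t γ t)
  · have hv0 : ∀ s ∈ Icc 0 t, velocity γ (0 : AngularVelocity t) s = 0 := fun s hs => by
      rw [← velocityL_apply hγ.continuousOn hs, map_zero]
    refine ⟨0, fun s hs _ => by rw [hv0 s hs, inner_zero_right], fun hf => ?_⟩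
    rw [tipVelocity_eq, hv0 t ⟨ht.le, le_rfl⟩, add_zero]
    exact hzero hf
  push Not at hzero
  obtain ⟨htf, htr⟩ := hzero
  by_cases hperp : tangent t γ t = -outerNormal Ω (γ t)
  swap
  · exact admissible_nonempty_of_tangent_ne_neg hΩ hΩ2 ht hγ hk hk1 hout htf htr hperp
  obtain ⟨s₀, hs₀, hs₀f, hs₀d⟩ : ∃ s ∈ Ioo 0 t, γ s ∉ frontier Ω ∧
      ¬ HasDerivAt (tangent t γ) 0 s := by
    by_contra! hcon
    exact hbreak ⟨htf, hperp, hcon⟩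
  have hfree : ∀ᶠ s in 𝓝 s₀, γ s ∉ frontier Ω :=
    (hasDerivAt_tangent hγ hs₀).continuousAt.eventually
      (isClosed_frontier.isOpen_compl.mem_nhds hs₀f)
  obtain ⟨ε, hε, hball⟩ := Metric.eventually_nhds_iff.1
    (hfree.and (Ioo_mem_nhds hs₀.1 hs₀.2))
  have hmem : ∀ s ∈ Icc (s₀ - ε / 2) (s₀ + ε / 2), γ s ∉ frontier Ω ∧ s ∈ Ioo 0 t := by
    intro s hs
    refine hball ?_
    rw [Real.dist_eq, abs_lt]
    constructor <;> linarith [hs.1, hs.2]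
  refine admissible_nonempty_of_bend hΩ hΩ2 ht hγ hκ hκk hk hk1 hout htf hperp
    (a := s₀ - ε / 2) (a' := s₀ - ε / 3) (b := s₀ + ε / 2)
    (hmem (s₀ - ε / 2) ⟨le_rfl, by linarith⟩).2.1.le (by linarith) (by linarith)
    (hmem (s₀ + ε / 2) ⟨by linarith, le_rfl⟩).2.2 (fun s hs => (hmem s hs).1) ?_
  by_contra! hconst
  refine hs₀d ((hasDerivAt_const s₀ (tangent t γ (s₀ - ε / 3))).congr_of_eventuallyEq ?_)
  filter_upwards [Icc_mem_nhds (show s₀ - ε / 3 < s₀ by linarith)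
    (show s₀ < s₀ + ε / 2 by linarith)] with s hs using hconst s hs

end Admissible

end RootGrowth

end

theorem mainTheorem2
    (Ω : Set RootGrowth.E3) (hΩ : IsOpen Ω) (hΩ2 : RootGrowth.HasC2Boundary Ω)
    (h : RootGrowth.E3 → ℝ) (hcont : ContinuousOn h Ωᶜ) (hnonneg : ∀ x ∈ Ωᶜ, 0 ≤ h x)
    (α : ℝ) (hα : 0 < α)
    (t : ℝ) (ht : 0 < t)
    (γ : ℝ → RootGrowth.E3) (hγ : RootGrowth.MemH2 t γ)
    (harc : ∀ s ∈ Set.Icc 0 t, ‖RootGrowth.tangent t γ s‖ = 1)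
    (hout : ∀ s ∈ Set.Icc 0 t, γ s ∉ Ω)
    (hbreak : ¬ RootGrowth.IsBreakdown Ω t γ) :
    ∃! ω : RootGrowth.AngularVelocity t,
      ω ∈ RootGrowth.admissible Ω t γ ∧
        ∀ ω' ∈ RootGrowth.admissible Ω t γ,
          RootGrowth.J h α γ ω ≤ RootGrowth.J h α γ ω' := by
  obtain ⟨hd, κ, hκ, hκk⟩ := hγ
  have hκi : IntervalIntegrable κ volume 0 t :=
    (intervalIntegrable_iff_integrableOn_Icc_of_le ht.le).2 (hκ.integrable one_le_two)
  have hk : ContinuousOn (RootGrowth.tangent t γ) (Icc 0 t) := by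
    have hp := intervalIntegral.continuousOn_primitive_interval' hκi left_mem_uIcc
    rw [uIcc_of_le ht.le] at hp
    exact (continuousOn_const.add hp).congr hκk
  exact RootGrowth.existsUnique_minimizer_of_admissible_nonempty ht hd.continuousOn hk
    (hcont.comp hd.continuousOn hout) (fun s hs => hnonneg _ (hout s hs)) harc hα.le
    (RootGrowth.admissible_nonempty hΩ hΩ2 ht hd hκi hκk hk harc hout hbreak)
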